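/- Proposition. For real parameters $p=(\eta,\theta;\sigma,\tau;\gamma)$ with $\gamma\ge -1$ put $K_p(a,b)=1+\eta b+\theta a+\sigma b^2+\tau a^2-(1-\gamma)ab$ and $D_p(s,u)=u(1+s\sigma)+\tau-s\gamma$. For a function $X$ put $\Delta_{s,u}(X)=\frac{X_u-X_s}{u-s}$ and $\widetilde\Delta_{s,u}(X)=\frac{uX_s-sX_u}{u-s}$. A square-integrable process $(X_t)_{t\in T}$ on a nonempty open interval $T\subset(0,\infty)$ is a quadratic harness, $X\in QH(\eta,\theta;\sigma,\tau;\gamma)$, if $\mathbb E X_t=0$, $\mathbb E X_sX_t=\min\{s,t\}$, and there are $\sigma$-fields $\mathcal F_{s,u}$ ($s<u$ in $T$), decreasing in the interval $(s,u)$, such that $X_r$ is $\mathcal F_{s,u}$-measurable for $r\le s$ and for $r\ge u$, and for all $s<t<u$ in $T$ $$\mathbb E(X_t|\mathcal F_{s,u})=\tfrac{u-t}{u-s}X_s+\tfrac{t-s}{u-s}X_u,\qquad \mathrm{Var}(X_t|\mathcal F_{s,u})=\frac{(u-t)(t-s)}{D_p(s,u)}\,K_p\big(\Delta_{s,u}(X),\widetilde\Delta_{s,u}(X)\big).$$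 Let $Z\in QH(\eta_Z,\theta_Z;\sigma_Z,\tau_Z;\gamma_Z)$ on $T$ be right-continuous (write $p=p_Z$ for its parameters), and let $R<V$, where $V\in T$ and either $R\in T$, or $R=0$, $(0,V)\subset T$ and $Z_0=0$. Let $\kappa$ be a regular conditional probability given $(Z_R,Z_V)$. Then the following holds for almost every value $(z_R,z_V)$ of $(Z_R,Z_V)$ such that $K_p(\Delta,\widetilde\Delta)>0$, where $\Delta=\frac{z_V-z_R}{V-R}$ and $\widetilde\Delta=\frac{Vz_R-Rz_V}{V-R}$. First, $D:=D_p(R,V)>0$. Put $M=\sqrt{K_p(\Delta,\widetilde\Delta)/D}$, let $X$ be the bridge, i.e. the process $Z$ on $(R,V)$ under the conditional law $\kappa(z_R,z_V)$, let $c\neq0$, and for $t>0$ let $Y_t=c\,Y^{0}_{t/c^2}$, where $$Y^0_t=\frac{\sqrt V}{(V-R)M}\Big((1+t/V)\,X_{(t+R)/(1+t/V)}-t z_V/V-z_R\Big).$$ Then $Y$ is a quadratic harness on $(0,\infty)$, with parameters $\eta_Y=\eta_0/c$, $\theta_Y=c\,\theta_0$, $\sigma_Y=\sigma_0/c^2$,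 $\tau_Y=c^2\tau_0$, $\gamma_Y=\gamma_0$, where (dropping the index $Z$ on the parameters of $Z$) $$\eta_0=\frac{-\theta+V\eta-2\tau\Delta+2\sigma V\widetilde\Delta-(1-\gamma)(V\Delta-\widetilde\Delta)}{\sqrt V\,M D},\qquad \theta_0=\frac{\sqrt V\big(\theta-R\eta+2\tau\Delta-2R\sigma\widetilde\Delta-(1-\gamma)(\widetilde\Delta-R\Delta)\big)}{M D},$$ $$\sigma_0=\frac{\sigma V^2+(1-\gamma)V+\tau}{V D},\qquad \tau_0=\frac{V(\sigma R^2+(1-\gamma)R+\tau)}{D},\qquad \gamma_0=\frac{V\gamma-R(V\sigma+1)-\tau}{D},$$ and these parameters satisfy: (i) $\gamma_Z=-1$ if and only if $\gamma_Y=-1$. (ii) If $\gamma_Z>-1$, then $\displaystyle\frac{(1-\gamma_Y)^2-4\sigma_Y\tau_Y}{(1+\gamma_Y)^2}=\frac{(1-\gamma_Z)^2-4\sigma_Z\tau_Z}{(1+\gamma_Z)^2}$. (iii) If $Z$ is a $q$-Meixner process, i.e. $\eta_Z=\sigma_Z=0$ and $\gamma_Z=q\in[-1,1]$, and if $R=0$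 and $z_R=0$, then $\mathrm{sign}(\theta_Y^2-4\tau_Y)=\mathrm{sign}(\theta_Z^2-4\tau_Z)$. In particular, (i)-(iii) hold for any $(\eta_Y,\theta_Y;\sigma_Y,\tau_Y;\gamma_Y)$ that is the only parameter vector with $Y\in QH(\eta_Y,\theta_Y;\sigma_Y,\tau_Y;\gamma_Y)$. -/

import Mathlib

open MeasureTheory ProbabilityTheory Set
open scoped ENNReal

/-- The numerical parameters `(η, θ; σ, τ; γ)` of a quadratic harness. -/
@[ext]
structure QHParams where
  η : ℝ
  θ : ℝ
  σ : ℝ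
  τ : ℝ
  γ : ℝ

/-- `Δ_{s,u}` of a function taking the value `x` at `s` and `y` at `u`. -/
noncomputable def slopeΔ (s u x y : ℝ) : ℝ := (y - x) / (u - s)

/-- The intercept (`Δ` with a tilde) of a function taking the value `x` at `s` and `y` at `u`. -/
noncomputable def interceptΔ (s u x y : ℝ) : ℝ := (u * x - s * y) / (u - s)

/-- The quadratic polynomial `K`, in the slope `a` and the intercept `b`. -/
def QHParams.K (p : QHParams) (a b : ℝ) : ℝ :=
  1 + p.η * b + p.θ * a + p.σ * b ^ 2 + p.τ * a ^ 2 - (1 - p.γ) * (a * b)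

/-- The denominator `u (1 + s σ) + τ - s γ`. -/
def QHParams.D (p : QHParams) (s u : ℝ) : ℝ := u * (1 + s * p.σ) + p.τ - s * p.γ

/-- The constant `F_{t,s,u}` in the conditional variance. -/
noncomputable def QHParams.F (p : QHParams) (t s u : ℝ) : ℝ :=
  (u - t) * (t - s) / p.D s u

/-- `X` is, on the open interval `T ⊆ (0, ∞)` and under the probability measure `P`, a quadratic
harness with parameters `p` with respect to the past-future filtration `ℱ`. -/
structure IsQuadraticHarness {Ω : Type*} [mΩ : MeasurableSpace Ω] (T : Set ℝ)
    (ℱ : ℝ → ℝ → MeasurableSpace Ω) (X : ℝ → Ω → ℝ) (P : Measure Ω) (p : QHParams) : Prop where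
  isOpen : IsOpen T
  ordConnected : T.OrdConnected
  nonempty : T.Nonempty
  pos : T ⊆ Ioi 0
  neg_one_le : -1 ≤ p.γ
  le : ∀ s ∈ T, ∀ u ∈ T, s < u → ℱ s u ≤ mΩ
  anti : ∀ r ∈ T, ∀ s ∈ T, ∀ t ∈ T, ∀ u ∈ T, r ≤ s → s < t → t ≤ u → ℱ r u ≤ ℱ s t
  measurable : ∀ s ∈ T, ∀ u ∈ T, s < u → ∀ r ∈ T, (r ≤ s ∨ u ≤ r) → Measurable[ℱ s u] (X r)
  memLp : ∀ t ∈ T, MemLp (X t) 2 P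
  mean : ∀ t ∈ T, ∫ ω, X t ω ∂P = 0
  cov : ∀ s ∈ T, ∀ t ∈ T, ∫ ω, X s ω * X t ω ∂P = min s t
  condMean : ∀ s ∈ T, ∀ t ∈ T, ∀ u ∈ T, s < t → t < u →
    P[X t | ℱ s u] =ᵐ[P] fun ω => (u - t) / (u - s) * X s ω + (t - s) / (u - s) * X u ω
  condVariance : ∀ s ∈ T, ∀ t ∈ T, ∀ u ∈ T, s < t → t < u →
    Var[X t; P | ℱ s u] =ᵐ[P] fun ω =>
      p.F t s u * p.K (slopeΔ s u (X s ω) (X u ω)) (interceptΔ s u (X s ω) (X u ω))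

/-- `X ∈ QH(η, θ; σ, τ; γ)` on the interval `T`, under `P`. -/
def MemQH {Ω : Type*} [MeasurableSpace Ω] (T : Set ℝ) (X : ℝ → Ω → ℝ) (P : Measure Ω)
    (p : QHParams) : Prop :=
  ∃ ℱ : ℝ → ℝ → MeasurableSpace Ω, IsQuadraticHarness T ℱ X P p

/-- `K` at the slope and intercept of the line through `(R, z.1)` and `(V, z.2)`. -/
noncomputable def QHParams.bridgeK (p : QHParams) (R V : ℝ) (z : ℝ × ℝ) : ℝ :=
  p.K (slopeΔ R V z.1 z.2) (interceptΔ R V z.1 z.2)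

/-- The normalization `M` of the bridge from `(R, z.1)` to `(V, z.2)`. -/
noncomputable def QHParams.bridgeM (p : QHParams) (R V : ℝ) (z : ℝ × ℝ) : ℝ :=
  √(p.bridgeK R V z) / √(p.D R V)

/-- The space-time transformation `Y` of a bridge `X` from `(R, z.1)` to `(V, z.2)` in a quadratic
harness with parameters `p`. -/
noncomputable def bridgeTransform {Ω : Type*} (p : QHParams) (R V : ℝ) (z : ℝ × ℝ)
    (X : ℝ → Ω → ℝ) (t : ℝ) (ω : Ω) : ℝ :=
  √V / ((V - R) * p.bridgeM R V z) *
    ((1 + t / V) * X ((t + R) / (1 + t / V)) ω - (t * z.2 / V + z.1))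

/-- The equivalent process `t ↦ c Y_{t / c²}`. -/
noncomputable def rescale {Ω : Type*} (c : ℝ) (Y : ℝ → Ω → ℝ) (t : ℝ) (ω : Ω) : ℝ :=
  c * Y (t / c ^ 2) ω

/-- The parameters of the transformed bridge. -/
noncomputable def QHParams.bridge (p : QHParams) (R V : ℝ) (z : ℝ × ℝ) : QHParams where
  η := (-p.θ + V * p.η - 2 * p.τ * slopeΔ R V z.1 z.2 + 2 * p.σ * V * interceptΔ R V z.1 z.2
      - (1 - p.γ) * (V * slopeΔ R V z.1 z.2 - interceptΔ R V z.1 z.2))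
    / (√V * p.bridgeM R V z * p.D R V)
  θ := √V * (p.θ - R * p.η + 2 * p.τ * slopeΔ R V z.1 z.2
      - 2 * R * p.σ * interceptΔ R V z.1 z.2
      - (1 - p.γ) * (interceptΔ R V z.1 z.2 - R * slopeΔ R V z.1 z.2))
    / (p.bridgeM R V z * p.D R V)
  σ := (p.σ * V ^ 2 + (1 - p.γ) * V + p.τ) / (V * p.D R V)
  τ := V * (p.σ * R ^ 2 + (1 - p.γ) * R + p.τ) / p.D R V
  γ := (V * p.γ - R * (V * p.σ + 1) - p.τ) / p.D R V

/-- The parameters of the rescaled process `t ↦ c Y_{t / c²}`. -/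
noncomputable def QHParams.rescale (p : QHParams) (c : ℝ) : QHParams where
  η := p.η / c
  θ := c * p.θ
  σ := p.σ / c ^ 2
  τ := c ^ 2 * p.τ
  γ := p.γ

/-- What is preserved when a process with parameters `p` is conditioned to pass through
`(R, z.1)` and `(V, z.2)` and the result has parameters `q`. -/
structure PreservedByConditioning (p q : QHParams) (R : ℝ) (z : ℝ × ℝ) : Prop where
  gamma_eq_neg_one_iff : p.γ = -1 ↔ q.γ = -1
  invariant : -1 < p.γ →
    ((1 - q.γ) ^ 2 - 4 * q.σ * q.τ) / (1 + q.γ) ^ 2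
      = ((1 - p.γ) ^ 2 - 4 * p.σ * p.τ) / (1 + p.γ) ^ 2
  sign_eq : p.η = 0 → p.σ = 0 → p.γ ∈ Icc (-1) 1 → R = 0 → z.1 = 0 →
    SignType.sign (q.θ ^ 2 - 4 * q.τ) = SignType.sign (p.θ ^ 2 - 4 * p.τ)

/-! Conditioning on `(Z R, Z V)` does not disturb the harness identities inside `(R, V)`: for `R ≤ s
< u ≤ V` the field `ℱ s u` already contains both endpoint values, so the linear conditional mean and
quadratic conditional variance hold, with the same coefficients, under almost every `κ z`. What
changes are the unconditional moments. The mean becomes the line through the two pinned points, and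
the covariance becomes that of a Brownian bridge multiplied by a constant determined by `K / D = M ^
2` at the endpoints.

The Möbius time change `bridgeTime` maps `(0, ∞)` into `(R, V)`, and the factor `1 + t / V` clears
its denominator, so affine functions of the old time become affine functions of the new time. After
centring and division by the right constant the covariance is `min s t`. Slopes and intercepts
transform linearly, so `K` is carried to another polynomial of the same shape, whose coefficients
are those of `QHParams.bridge` (`QHParams.bridge_K`, `QHParams.bridge_D`). The invariants then
follow because `1 + γ` is multiplied by `(V - R) / D`, `(1 - γ) ^ 2 - 4 σ τ` by its square, and, in
the Meixner case, `θ ^ 2 - 4 τ` by a positive number.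

The analytic difficulty is exceptional sets: each identity fails on its own null set of `z`, and
there are uncountably many times and events. `ae_forall_setIntegral_eq_of_condExp` handles all
events of a countably generated field at once, `IsQuadraticHarness.ae_bridgeLaw_rat` collects the
identities at rational times, and `BridgeLaw.of_rightContinuous` extends them to all times. The
positivity of `D` comes from `IsQuadraticHarness.K_nonpos_or_D_pos`. -/

open Filter Topology

/-! ### Transfer of identities from `P` to the conditional laws `κ z` -/

section Disintegration

variable {Ω E : Type*} {F G : MeasurableSpace Ω} [mΩ : MeasurableSpace Ω] [MeasurableSpace E]
  {P : Measure Ω} {W : Ω → E} {κ : Kernel E Ω}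

theorem ae_ae_of_disintegration [IsProbabilityMeasure P] [IsMarkovKernel κ]
    (hW : Measurable W)
    (hκ : (P.map W) ⊗ₘ κ = P.map fun ω => (W ω, ω)) {p : Ω → Prop} (hp : ∀ᵐ ω ∂P, p ω) :
    ∀ᵐ z ∂(P.map W), ∀ᵐ ω ∂(κ z), p ω := by
  have hm : Measurable fun ω => (W ω, ω) := hW.prodMk measurable_id
  have h : Measure.map Prod.snd (P.map fun ω => (W ω, ω)) = P := by
    rw [Measure.map_map measurable_snd hm]
    exact Measure.map_id
  have h2 : ∀ᵐ x ∂((P.map W) ⊗ₘ κ), p x.2 := by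
    rw [hκ]
    exact ae_of_ae_map (μ := P.map fun ω => (W ω, ω)) measurable_snd.aemeasurable (h.symm ▸ hp)
  exact Measure.ae_ae_of_ae_compProd h2

/-- The joint law of `(W ω, ω)` is carried by the graph of `W`, so its fibre over `z` is carried by
`{W = z}`. -/
theorem ae_ae_eq_of_disintegration [MeasurableEq E] [IsProbabilityMeasure P] [IsMarkovKernel κ]
    (hW : Measurable W) (hκ : (P.map W) ⊗ₘ κ = P.map fun ω => (W ω, ω)) :
    ∀ᵐ z ∂(P.map W), ∀ᵐ ω ∂(κ z), W ω = z := by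
  have hm : Measurable fun ω => (W ω, ω) := hW.prodMk measurable_id
  have h2 : ∀ᵐ x ∂((P.map W) ⊗ₘ κ), W x.2 = x.1 := by
    have hs : MeasurableSet {x : E × Ω | W x.2 = x.1} :=
      measurableSet_eq_fun (hW.comp measurable_snd) measurable_fst
    rw [hκ, ae_map_iff hm.aemeasurable hs]
    simp
  exact Measure.ae_ae_of_ae_compProd h2

theorem integrable_comp_snd_of_disintegration (hW : Measurable W)
    (hκ : (P.map W) ⊗ₘ κ = P.map fun ω => (W ω, ω)) {f : Ω → ℝ} (hf : Integrable f P) :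
    Integrable (fun x : E × Ω => f x.2) ((P.map W) ⊗ₘ κ) := by
  have hm : Measurable fun ω => (W ω, ω) := hW.prodMk measurable_id
  have h : Measure.map Prod.snd (P.map fun ω => (W ω, ω)) = P := by
    rw [Measure.map_map measurable_snd hm]
    exact Measure.map_id
  rw [hκ]
  refine Integrable.comp_measurable (μ := P.map fun ω => (W ω, ω)) ?_ measurable_snd
  rwa [h]

theorem ae_integrable_of_disintegration [IsProbabilityMeasure P] [IsMarkovKernel κ]
    (hW : Measurable W)
    (hκ : (P.map W) ⊗ₘ κ = P.map fun ω => (W ω, ω)) {f : Ω → ℝ} (hf : Integrable f P) :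
    ∀ᵐ z ∂(P.map W), Integrable f (κ z) := by
  have := integrable_comp_snd_of_disintegration hW hκ hf
  exact ((Measure.integrable_compProd_iff this.1).1 this).1

theorem ae_memLp_two_of_disintegration [IsProbabilityMeasure P] [IsMarkovKernel κ]
    (hW : Measurable W)
    (hκ : (P.map W) ⊗ₘ κ = P.map fun ω => (W ω, ω)) {f : Ω → ℝ} (hm : Measurable f)
    (hf : MemLp f 2 P) : ∀ᵐ z ∂(P.map W), MemLp f 2 (κ z) := by
  filter_upwards [ae_integrable_of_disintegration hW hκ hf.integrable_sq] with z hz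
  exact (memLp_two_iff_integrable_sq hm.aestronglyMeasurable).2 hz

theorem setIntegral_of_disintegration [IsProbabilityMeasure P] [IsMarkovKernel κ]
    (hW : Measurable W)
    (hκ : (P.map W) ⊗ₘ κ = P.map fun ω => (W ω, ω)) {f : Ω → ℝ} (hf : Integrable f P)
    {B : Set E} (hB : MeasurableSet B) :
    ∫ z in B, ∫ ω, f ω ∂(κ z) ∂(P.map W) = ∫ ω in W ⁻¹' B, f ω ∂P := by
  have hm : Measurable fun ω => (W ω, ω) := hW.prodMk measurable_id
  have hi := integrable_comp_snd_of_disintegration hW hκ hf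
  have h1 := Measure.setIntegral_compProd hB MeasurableSet.univ (hi.integrableOn (s := B ×ˢ univ))
  simp only [Measure.restrict_univ] at h1
  rw [← h1, hκ, setIntegral_map (hB.prod MeasurableSet.univ) (hκ ▸ hi.1) hm.aemeasurable]
  congr 2
  ext ω
  simp

/-- If the integrals of `f` and `g` agree on `σ(W)`, their conditional integrals agree. -/
theorem ae_integral_eq_of_disintegration [IsProbabilityMeasure P] [IsMarkovKernel κ]
    (hW : Measurable W)
    (hκ : (P.map W) ⊗ₘ κ = P.map fun ω => (W ω, ω)) {f g : Ω → ℝ} (hf : Integrable f P)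
    (hg : Integrable g P)
    (hfg : ∀ B, MeasurableSet B → ∫ ω in W ⁻¹' B, f ω ∂P = ∫ ω in W ⁻¹' B, g ω ∂P) :
    ∀ᵐ z ∂(P.map W), ∫ ω, f ω ∂(κ z) = ∫ ω, g ω ∂(κ z) := by
  have key : ∀ f : Ω → ℝ, Integrable f P →
      Integrable (fun z => ∫ ω, f ω ∂(κ z)) (P.map W) := fun f hf =>
    (integrable_comp_snd_of_disintegration hW hκ hf).integral_compProd
  refine Integrable.ae_eq_of_forall_setIntegral_eq _ _ (key f hf) (key g hg) fun B hB _ => ?_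
  rw [setIntegral_of_disintegration hW hκ hf hB, setIntegral_of_disintegration hW hκ hg hB,
    hfg B hB]

theorem ae_integral_eq_of_condExp [IsProbabilityMeasure P] [IsMarkovKernel κ]
    (hF : F ≤ mΩ) (hW : Measurable W) (hWF : Measurable[F] W)
    (hκ : (P.map W) ⊗ₘ κ = P.map fun ω => (W ω, ω)) {f g : Ω → ℝ} (hf : Integrable f P)
    (hfg : P[f | F] =ᵐ[P] g) :
    ∀ᵐ z ∂(P.map W), ∫ ω, f ω ∂(κ z) = ∫ ω, g ω ∂(κ z) := by
  refine ae_integral_eq_of_disintegration hW hκ hf (integrable_condExp.congr hfg) fun B hB => ?_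
  rw [← setIntegral_condExp hF hf (hWF hB)]
  exact setIntegral_congr_ae (hW hB) (hfg.mono fun _ h _ => h)

/-- One null set of `z` must serve all `A`, and `F` may be too large for that. A countably generated
`G ≤ F` has a countable generating algebra: discard a null set for each of its members, then extend
to `G` by a π-λ argument. -/
theorem ae_forall_setIntegral_eq_of_condExp [IsProbabilityMeasure P] [IsMarkovKernel κ]
    (hF : F ≤ mΩ)
    (hGF : G ≤ F) (hG : @MeasurableSpace.CountablyGenerated Ω G) (hW : Measurable W)
    (hWF : Measurable[F] W)
    (hκ : (P.map W) ⊗ₘ κ = P.map fun ω => (W ω, ω)) {f g : Ω → ℝ} (hf : Integrable f P)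
    (hfg : P[f | F] =ᵐ[P] g) :
    ∀ᵐ z ∂(P.map W), ∀ A, MeasurableSet[G] A → ∫ ω in A, f ω ∂(κ z) = ∫ ω in A, g ω ∂(κ z) := by
  obtain ⟨b, hbc, hb⟩ := hG.isCountablyGenerated
  have hgen : G = MeasurableSpace.generateFrom (generateSetAlgebra b) := by
    rw [generateFrom_generateSetAlgebra_eq, hb]
  have hpi : IsPiSystem (generateSetAlgebra b) := fun s hs t ht _ =>
    isSetAlgebra_generateSetAlgebra.inter_mem hs ht
  have hg : Integrable g P := integrable_condExp.congr hfg
  have hmeas : ∀ A ∈ generateSetAlgebra b, MeasurableSet[F] A := fun A hA =>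
    hGF _ (hgen ▸ MeasurableSpace.measurableSet_generateFrom hA)
  have hbase : ∀ᵐ z ∂(P.map W), ∀ A ∈ generateSetAlgebra b,
      ∫ ω in A, f ω ∂(κ z) = ∫ ω in A, g ω ∂(κ z) := by
    rw [ae_ball_iff (countable_generateSetAlgebra hbc)]
    intro A hA
    have hAF := hmeas A hA
    have hAm := hF _ hAF
    have := ae_integral_eq_of_disintegration hW hκ (hf.indicator hAm) (hg.indicator hAm)
      (fun B hB => by
        rw [setIntegral_indicator hAm, setIntegral_indicator hAm,
          ← setIntegral_condExp hF hf ((hWF hB).inter hAF)]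
        exact setIntegral_congr_ae ((hW hB).inter hAm) (hfg.mono fun _ h _ => h))
    filter_upwards [this] with z hz
    rwa [integral_indicator hAm, integral_indicator hAm] at hz
  -- Equality of the total integrals is what the complement step of the induction needs.
  have htot := ae_integral_eq_of_condExp hF hW hWF hκ hf hfg
  filter_upwards [hbase, htot, ae_integrable_of_disintegration hW hκ hf,
    ae_integrable_of_disintegration hW hκ hg] with z hz hzt hzf hzg A hA
  induction A, hA using MeasurableSpace.induction_on_inter hgen hpi with
  | empty => simp
  | basic A hA => exact hz A hA
  | compl A hA ih =>
    have hAm := hF _ (hGF _ hA)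
    have h1 := integral_add_compl hAm hzf
    have h2 := integral_add_compl hAm hzg
    linarith
  | iUnion A hd hA ih =>
    have hAm := fun i => hF _ (hGF _ (hA i))
    rw [integral_iUnion hAm hd hzf.integrableOn, integral_iUnion hAm hd hzg.integrableOn]
    simp only [ih]

end Disintegration

/-! ### Convergence in `L²` and its effect on first and second moments -/

section TendstoInL2

variable {Ω : Type*} [mΩ : MeasurableSpace Ω] {Q : Measure Ω}

/-- Convergence of real random variables in `L²`. -/
def TendstoInL2 (f : ℕ → Ω → ℝ) (g : Ω → ℝ) (Q : Measure Ω) : Prop :=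
  ∃ (hf : ∀ n, MemLp (f n) 2 Q) (hg : MemLp g 2 Q),
    Tendsto (fun n => (hf n).toLp (f n)) atTop (𝓝 (hg.toLp g))

theorem tendstoInL2_of_eLpNorm {f : ℕ → Ω → ℝ} {g : Ω → ℝ} (hf : ∀ n, MemLp (f n) 2 Q)
    (hg : MemLp g 2 Q) (h : Tendsto (fun n => eLpNorm (f n - g) 2 Q) atTop (𝓝 0)) :
    TendstoInL2 f g Q :=
  ⟨hf, hg, (Lp.tendsto_Lp_iff_tendsto_eLpNorm'' f hf g hg).2 h⟩

theorem TendstoInL2.const {g : Ω → ℝ} (hg : MemLp g 2 Q) : TendstoInL2 (fun _ => g) g Q :=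
  ⟨fun _ => hg, hg, tendsto_const_nhds⟩

theorem TendstoInL2.add {f f' : ℕ → Ω → ℝ} {g g' : Ω → ℝ} (h : TendstoInL2 f g Q)
    (h' : TendstoInL2 f' g' Q) :
    TendstoInL2 (fun n ω => f n ω + f' n ω) (fun ω => g ω + g' ω) Q := by
  obtain ⟨hf, hg, ht⟩ := h
  obtain ⟨hf', hg', ht'⟩ := h'
  exact ⟨fun n => (hf n).add (hf' n), hg.add hg', ht.add ht'⟩

theorem TendstoInL2.const_mul {f : ℕ → Ω → ℝ} {g : Ω → ℝ} (h : TendstoInL2 f g Q) {c : ℕ → ℝ}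
    {d : ℝ} (hc : Tendsto c atTop (𝓝 d)) :
    TendstoInL2 (fun n ω => c n * f n ω) (fun ω => d * g ω) Q := by
  obtain ⟨hf, hg, ht⟩ := h
  exact ⟨fun n => (hf n).const_mul (c n), hg.const_mul d, hc.smul ht⟩

theorem TendstoInL2.restrict {f : ℕ → Ω → ℝ} {g : Ω → ℝ} (h : TendstoInL2 f g Q) (A : Set Ω) :
    TendstoInL2 f g (Q.restrict A) := by
  obtain ⟨hf, hg, ht⟩ := h
  refine tendstoInL2_of_eLpNorm (fun n => (hf n).restrict A) (hg.restrict A) ?_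
  exact tendsto_of_tendsto_of_tendsto_of_le_of_le tendsto_const_nhds
    ((Lp.tendsto_Lp_iff_tendsto_eLpNorm'' f hf g hg).1 ht) (fun _ => zero_le)
    (fun n => eLpNorm_mono_measure _ Measure.restrict_le_self)

/-- The integral of a product is the `L²` inner product, which is jointly continuous. Every
quadratic limit below rests on this. -/
theorem TendstoInL2.integral_mul {f f' : ℕ → Ω → ℝ} {g g' : Ω → ℝ} (h : TendstoInL2 f g Q)
    (h' : TendstoInL2 f' g' Q) :
    Tendsto (fun n => ∫ ω, f n ω * f' n ω ∂Q) atTop (𝓝 (∫ ω, g ω * g' ω ∂Q)) := by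
  obtain ⟨hf, hg, ht⟩ := h
  obtain ⟨hf', hg', ht'⟩ := h'
  have key : ∀ {f g : Ω → ℝ} (hf : MemLp f 2 Q) (hg : MemLp g 2 Q),
      inner ℝ (hf.toLp f) (hg.toLp g) = ∫ ω, f ω * g ω ∂Q := by
    intro f g hf hg
    rw [L2.inner_def]
    refine integral_congr_ae ?_
    filter_upwards [hf.coeFn_toLp, hg.coeFn_toLp] with ω h1 h2
    rw [h1, h2]
    simp [mul_comm]
  simpa only [key] using Filter.Tendsto.inner (𝕜 := ℝ) ht ht'

theorem TendstoInL2.integral [IsFiniteMeasure Q] {f : ℕ → Ω → ℝ} {g : Ω → ℝ}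
    (h : TendstoInL2 f g Q) : Tendsto (fun n => ∫ ω, f n ω ∂Q) atTop (𝓝 (∫ ω, g ω ∂Q)) := by
  simpa using h.integral_mul (TendstoInL2.const (memLp_const (1 : ℝ)))

theorem QHParams.integrable_K [IsFiniteMeasure Q] (p : QHParams) {a b : Ω → ℝ}
    (ha : MemLp a 2 Q) (hb : MemLp b 2 Q) : Integrable (fun ω => p.K (a ω) (b ω)) Q := by
  have h1 := ha.integrable one_le_two
  have h2 := hb.integrable one_le_two
  exact (((((integrable_const (1 : ℝ)).add (h2.const_mul p.η)).add (h1.const_mul p.θ)).add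
    (hb.integrable_sq.const_mul p.σ)).add (ha.integrable_sq.const_mul p.τ)).sub
    ((ha.integrable_mul hb).const_mul (1 - p.γ))

theorem QHParams.integral_K [IsFiniteMeasure Q] (p : QHParams) {a b : Ω → ℝ}
    (ha : MemLp a 2 Q) (hb : MemLp b 2 Q) :
    ∫ ω, p.K (a ω) (b ω) ∂Q = ∫ _, (1 : ℝ) ∂Q + p.η * ∫ ω, b ω ∂Q + p.θ * ∫ ω, a ω ∂Q
      + p.σ * ∫ ω, b ω * b ω ∂Q + p.τ * ∫ ω, a ω * a ω ∂Q
      - (1 - p.γ) * ∫ ω, a ω * b ω ∂Q := by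
  have h1 := ha.integrable one_le_two
  have h2 := hb.integrable one_le_two
  have i0 : Integrable (fun _ : Ω => (1 : ℝ)) Q := integrable_const _
  have i1 := h2.const_mul p.η
  have i2 := h1.const_mul p.θ
  have i3 := (hb.integrable_mul hb).const_mul p.σ
  have i4 := (ha.integrable_mul ha).const_mul p.τ
  have i5 := (ha.integrable_mul hb).const_mul (1 - p.γ)
  have h : (fun ω => p.K (a ω) (b ω)) = (fun _ => (1 : ℝ)) + (fun ω => p.η * b ω)
      + (fun ω => p.θ * a ω) + (fun ω => p.σ * (b * b) ω) + (fun ω => p.τ * (a * a) ω)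
      - (fun ω => (1 - p.γ) * (a * b) ω) := by
    funext ω
    simp only [QHParams.K, Pi.add_apply, Pi.mul_apply, Pi.sub_apply]
    ring
  rw [h, integral_sub' ((((i0.add i1).add i2).add i3).add i4) i5,
    integral_add' (((i0.add i1).add i2).add i3) i4, integral_add' ((i0.add i1).add i2) i3,
    integral_add' (i0.add i1) i2, integral_add' i0 i1]
  simp only [integral_const_mul, Pi.mul_apply]

theorem TendstoInL2.integral_K [IsFiniteMeasure Q] (p : QHParams) {a b : ℕ → Ω → ℝ}
    {a' b' : Ω → ℝ} (ha : TendstoInL2 a a' Q) (hb : TendstoInL2 b b' Q) :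
    Tendsto (fun n => ∫ ω, p.K (a n ω) (b n ω) ∂Q) atTop (𝓝 (∫ ω, p.K (a' ω) (b' ω) ∂Q)) := by
  rw [p.integral_K ha.2.1 hb.2.1]
  simp only [fun n => p.integral_K (ha.1 n) (hb.1 n)]
  exact ((((tendsto_const_nhds.add (hb.integral.const_mul _)).add
    (ha.integral.const_mul _)).add ((hb.integral_mul hb).const_mul _)).add
    ((ha.integral_mul ha).const_mul _)).sub ((ha.integral_mul hb).const_mul _)

theorem memLp_slopeΔ {X Y : Ω → ℝ} (hX : MemLp X 2 Q) (hY : MemLp Y 2 Q) (s u : ℝ) :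
    MemLp (fun ω => slopeΔ s u (X ω) (Y ω)) 2 Q := by
  simpa [slopeΔ, div_eq_inv_mul] using (hY.sub hX).const_mul (u - s)⁻¹

theorem memLp_interceptΔ {X Y : Ω → ℝ} (hX : MemLp X 2 Q) (hY : MemLp Y 2 Q) (s u : ℝ) :
    MemLp (fun ω => interceptΔ s u (X ω) (Y ω)) 2 Q := by
  simpa [interceptΔ, div_eq_inv_mul] using
    ((hX.const_mul u).sub (hY.const_mul s)).const_mul (u - s)⁻¹

variable {X Y : ℕ → Ω → ℝ} {X' Y' : Ω → ℝ} {s u : ℕ → ℝ} {s' u' : ℝ}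

theorem TendstoInL2.slopeΔ (hX : TendstoInL2 X X' Q) (hY : TendstoInL2 Y Y' Q)
    (hs : Tendsto s atTop (𝓝 s')) (hu : Tendsto u atTop (𝓝 u')) (hsu : s' < u') :
    TendstoInL2 (fun n ω => slopeΔ (s n) (u n) (X n ω) (Y n ω))
      (fun ω => _root_.slopeΔ s' u' (X' ω) (Y' ω)) Q := by
  have hi := (hu.sub hs).inv₀ (sub_ne_zero.2 hsu.ne')
  have := (hY.const_mul hi).add (hX.const_mul hi.neg)
  convert this using 1
  · funext n ω; rw [_root_.slopeΔ]; ring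
  · funext ω; rw [_root_.slopeΔ]; ring

theorem TendstoInL2.interceptΔ (hX : TendstoInL2 X X' Q) (hY : TendstoInL2 Y Y' Q)
    (hs : Tendsto s atTop (𝓝 s')) (hu : Tendsto u atTop (𝓝 u')) (hsu : s' < u') :
    TendstoInL2 (fun n ω => interceptΔ (s n) (u n) (X n ω) (Y n ω))
      (fun ω => _root_.interceptΔ s' u' (X' ω) (Y' ω)) Q := by
  have hi := (hu.sub hs).inv₀ (sub_ne_zero.2 hsu.ne')
  have := (hX.const_mul (hu.mul hi)).add (hY.const_mul (hs.mul hi.neg))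
  convert this using 1
  · funext n ω; rw [_root_.interceptΔ]; ring
  · funext ω; rw [_root_.interceptΔ]; ring

end TendstoInL2

/-! ### Conditional moments of a harness, as functionals continuous in `L²` -/

/-- The value at `t` of the affine function through `(s, x)` and `(u, y)`. -/
noncomputable def linInterp (s t u x y : ℝ) : ℝ := (u - t) / (u - s) * x + (t - s) / (u - s) * y

/-- The conditional second moment at `t` of a quadratic harness, given the values `x` at `s` and
`y` at `u`. -/
noncomputable def QHParams.condSq (p : QHParams) (s t u x y : ℝ) : ℝ :=
  linInterp s t u x y ^ 2 + p.F t s u * p.K (slopeΔ s u x y) (interceptΔ s u x y)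

section Limits

variable {Ω : Type*} [mΩ : MeasurableSpace Ω] {Q : Measure Ω}

theorem memLp_linInterp {X Y : Ω → ℝ} (hX : MemLp X 2 Q) (hY : MemLp Y 2 Q) (s t u : ℝ) :
    MemLp (fun ω => linInterp s t u (X ω) (Y ω)) 2 Q :=
  (hX.const_mul _).add (hY.const_mul _)

theorem integrable_condSq [IsFiniteMeasure Q] {X Y : Ω → ℝ} (hX : MemLp X 2 Q)
    (hY : MemLp Y 2 Q) (p : QHParams) (s t u : ℝ) :
    Integrable (fun ω => p.condSq s t u (X ω) (Y ω)) Q :=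
  (memLp_linInterp hX hY s t u).integrable_sq.add
    ((p.integrable_K (memLp_slopeΔ hX hY s u) (memLp_interceptΔ hX hY s u)).const_mul _)

theorem integral_condSq [IsFiniteMeasure Q] {X Y : Ω → ℝ} (hX : MemLp X 2 Q)
    (hY : MemLp Y 2 Q) (p : QHParams) (s t u : ℝ) :
    ∫ ω, p.condSq s t u (X ω) (Y ω) ∂Q = ∫ ω, linInterp s t u (X ω) (Y ω) ^ 2 ∂Q +
      p.F t s u * ∫ ω, p.K (slopeΔ s u (X ω) (Y ω)) (interceptΔ s u (X ω) (Y ω)) ∂Q := by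
  rw [← integral_const_mul]
  exact integral_add (memLp_linInterp hX hY s t u).integrable_sq
    ((p.integrable_K (memLp_slopeΔ hX hY s u) (memLp_interceptΔ hX hY s u)).const_mul _)

variable {X Y Z : ℕ → Ω → ℝ} {X' Y' Z' : Ω → ℝ} {s t u : ℕ → ℝ} {s' t' u' : ℝ}

theorem TendstoInL2.linInterp (hX : TendstoInL2 X X' Q) (hY : TendstoInL2 Y Y' Q)
    (hs : Tendsto s atTop (𝓝 s')) (ht : Tendsto t atTop (𝓝 t')) (hu : Tendsto u atTop (𝓝 u'))
    (hsu : s' < u') :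
    TendstoInL2 (fun n ω => linInterp (s n) (t n) (u n) (X n ω) (Y n ω))
      (fun ω => _root_.linInterp s' t' u' (X' ω) (Y' ω)) Q :=
  (hX.const_mul ((hu.sub ht).div (hu.sub hs) (sub_ne_zero.2 hsu.ne'))).add
    (hY.const_mul ((ht.sub hs).div (hu.sub hs) (sub_ne_zero.2 hsu.ne')))

theorem TendstoInL2.integral_condSq [IsFiniteMeasure Q] (p : QHParams)
    (hX : TendstoInL2 X X' Q) (hY : TendstoInL2 Y Y' Q)
    (hs : Tendsto s atTop (𝓝 s')) (ht : Tendsto t atTop (𝓝 t')) (hu : Tendsto u atTop (𝓝 u'))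
    (hsu : s' < u') (hD : p.D s' u' ≠ 0) :
    Tendsto (fun n => ∫ ω, p.condSq (s n) (t n) (u n) (X n ω) (Y n ω) ∂Q) atTop
      (𝓝 (∫ ω, p.condSq s' t' u' (X' ω) (Y' ω) ∂Q)) := by
  rw [_root_.integral_condSq hX.2.1 hY.2.1]
  simp only [fun n => _root_.integral_condSq (hX.1 n) (hY.1 n)]
  have hl := hX.linInterp hY hs ht hu hsu
  refine Tendsto.add ?_ (Tendsto.mul ?_ ?_)
  · simpa only [sq] using hl.integral_mul hl
  · refine ((hu.sub ht).mul (ht.sub hs)).div ?_ hD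
    exact ((hu.mul ((hs.mul_const _).const_add 1)).add_const _).sub (hs.mul_const _)
  · exact TendstoInL2.integral_K p (hX.slopeΔ hY hs hu hsu) (hX.interceptΔ hY hs hu hsu)

theorem integral_linear_mul [IsFiniteMeasure Q] {X Y : Ω → ℝ} (hX : MemLp X 2 Q)
    (hY : MemLp Y 2 Q) (a b c d : ℝ) :
    ∫ ω, (a * X ω + b * Y ω) * (c * X ω + d * Y ω) ∂Q = a * c * ∫ ω, X ω * X ω ∂Q
      + (a * d + b * c) * ∫ ω, X ω * Y ω ∂Q + b * d * ∫ ω, Y ω * Y ω ∂Q := by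
  have i1 := (hX.integrable_mul hX).const_mul (a * c)
  have i2 := (hX.integrable_mul hY).const_mul (a * d + b * c)
  have i3 := (hY.integrable_mul hY).const_mul (b * d)
  have h : (fun ω => (a * X ω + b * Y ω) * (c * X ω + d * Y ω)) =
      (fun ω => a * c * (X * X) ω) + (fun ω => (a * d + b * c) * (X * Y) ω)
        + (fun ω => b * d * (Y * Y) ω) := by
    funext ω
    simp only [Pi.add_apply, Pi.mul_apply]
    ring
  rw [h, integral_add' (i1.add i2) i3, integral_add' i1 i2]
  simp only [integral_const_mul, Pi.mul_apply]

theorem integral_linear [IsFiniteMeasure Q] {X Y : Ω → ℝ} (hX : MemLp X 2 Q)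
    (hY : MemLp Y 2 Q) (a b : ℝ) :
    ∫ ω, (a * X ω + b * Y ω) ∂Q = a * ∫ ω, X ω ∂Q + b * ∫ ω, Y ω ∂Q := by
  rw [integral_add ((hX.integrable one_le_two).const_mul a)
    ((hY.integrable one_le_two).const_mul b), integral_const_mul, integral_const_mul]

theorem slopeΔ_eq (s u x y : ℝ) : slopeΔ s u x y = -(u - s)⁻¹ * x + (u - s)⁻¹ * y := by
  rw [slopeΔ]; ring

theorem interceptΔ_eq (s u x y : ℝ) :
    interceptΔ s u x y = u * (u - s)⁻¹ * x + -s * (u - s)⁻¹ * y := by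
  rw [interceptΔ]; ring

/-- The covariance `min s u` alone determines the expectation of `K`, which ties the sign of `D` to
that of `K`. -/
theorem integral_K_of_cov [IsProbabilityMeasure Q] (p : QHParams) {X Y : Ω → ℝ} {s u : ℝ}
    (hX : MemLp X 2 Q) (hY : MemLp Y 2 Q) (hsu : s < u) (hX0 : ∫ ω, X ω ∂Q = 0)
    (hY0 : ∫ ω, Y ω ∂Q = 0) (hXX : ∫ ω, X ω * X ω ∂Q = s) (hXY : ∫ ω, X ω * Y ω ∂Q = s)
    (hYY : ∫ ω, Y ω * Y ω ∂Q = u) :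
    ∫ ω, p.K (slopeΔ s u (X ω) (Y ω)) (interceptΔ s u (X ω) (Y ω)) ∂Q = p.D s u / (u - s) := by
  rw [p.integral_K (memLp_slopeΔ hX hY s u) (memLp_interceptΔ hX hY s u)]
  simp only [slopeΔ_eq, interceptΔ_eq, integral_linear_mul hX hY, integral_linear hX hY, hX0, hY0,
    hXX, hXY, hYY, QHParams.D]
  have : u - s ≠ 0 := sub_ne_zero.2 hsu.ne'
  simp only [integral_const, probReal_univ, smul_eq_mul]
  field_simp
  ring

end Limits

/-! ### Nondegeneracy and sign of the denominator `D` -/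

namespace IsQuadraticHarness

variable {Ω : Type*} [mΩ : MeasurableSpace Ω] {T : Set ℝ} {ℱ : ℝ → ℝ → MeasurableSpace Ω}
  {X : ℝ → Ω → ℝ} {P : Measure Ω} {p : QHParams} {s t u : ℝ}

theorem mem_of_lt_of_lt (h : IsQuadraticHarness T ℱ X P p) (hs : s ∈ T) (hu : u ∈ T)
    (hst : s < t) (htu : t < u) : t ∈ T :=
  h.ordConnected.out hs hu ⟨hst.le, htu.le⟩

theorem measurable_apply (h : IsQuadraticHarness T ℱ X P p) (ht : t ∈ T) : Measurable (X t) := by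
  obtain ⟨ε, hε, hb⟩ := Metric.isOpen_iff.1 h.isOpen t ht
  -- Openness of `T` supplies a later time, and hence a field of the filtration that contains `X t`.
  have hu : t + ε / 2 ∈ T := hb (by simp [abs_of_pos hε, hε])
  have hlt : t < t + ε / 2 := by linarith
  exact (h.measurable t ht _ hu hlt t ht (Or.inl le_rfl)).mono (h.le t ht _ hu hlt) le_rfl

theorem condExp_sq [IsProbabilityMeasure P]
    (h : IsQuadraticHarness T ℱ X P p) (hs : s ∈ T) (ht : t ∈ T) (hu : u ∈ T)
    (hst : s < t) (htu : t < u) :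
    P[fun ω => X t ω ^ 2 | ℱ s u] =ᵐ[P] fun ω => p.condSq s t u (X s ω) (X u ω) := by
  filter_upwards [condVar_ae_eq_condExp_sq_sub_sq_condExp (h.le s hs u hu (hst.trans htu))
    (h.memLp t ht), h.condMean s hs t ht u hu hst htu, h.condVariance s hs t ht u hu hst htu]
    with ω h1 h2 h3
  rw [h3, Pi.sub_apply, Pi.pow_apply, h2] at h1
  simp only [QHParams.condSq, linInterp]
  rw [h1]
  change P[X t ^ 2 | ℱ s u] ω = _
  ring

/-- If `D` vanished, division by zero would make the conditional variance zero, and `X t` would have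
the second moment of its linear interpolant. The covariance rules this out: the two differ by `(t -
s) (u - t) / (u - s)`. -/
theorem D_ne_zero [IsProbabilityMeasure P]
    (h : IsQuadraticHarness T ℱ X P p) (hs : s ∈ T) (hu : u ∈ T) (hsu : s < u) :
    p.D s u ≠ 0 := by
  intro hD
  obtain ⟨t, hst, htu⟩ := exists_between hsu
  have ht := h.mem_of_lt_of_lt hs hu hst htu
  have h1 : ∫ ω, X t ω ^ 2 ∂P = ∫ ω, p.condSq s t u (X s ω) (X u ω) ∂P := by
    rw [← integral_condExp (h.le s hs u hu hsu)]
    exact integral_congr_ae (h.condExp_sq hs ht hu hst htu)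
  rw [integral_condSq (h.memLp s hs) (h.memLp u hu), QHParams.F, hD, div_zero,
    zero_mul, add_zero] at h1
  simp only [linInterp, sq, integral_linear_mul (h.memLp s hs) (h.memLp u hu), h.cov s hs s hs,
    h.cov s hs u hu, h.cov u hu u hu, h.cov t ht t ht, min_self, min_eq_left hsu.le] at h1
  have hne : u - s ≠ 0 := sub_ne_zero.2 hsu.ne'
  field_simp at h1
  have h2 : (t - s) * ((u - t) * (u - s)) = 0 := by linear_combination h1
  exact (mul_pos (sub_pos.2 hst) (mul_pos (sub_pos.2 htu) (sub_pos.2 hsu))).ne' h2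

theorem K_div_D_nonneg [IsProbabilityMeasure P]
    (h : IsQuadraticHarness T ℱ X P p) (hs : s ∈ T) (hu : u ∈ T)
    (hsu : s < u) :
    ∀ᵐ ω ∂P, 0 ≤ p.K (slopeΔ s u (X s ω) (X u ω)) (interceptΔ s u (X s ω) (X u ω)) / p.D s u := by
  obtain ⟨t, hst, htu⟩ := exists_between hsu
  have ht := h.mem_of_lt_of_lt hs hu hst htu
  have h0 : 0 ≤ᵐ[P] Var[X t; P | ℱ s u] :=
    condExp_nonneg (ae_of_all _ fun ω => sq_nonneg _)
  filter_upwards [h0, h.condVariance s hs t ht u hu hst htu] with ω h1 h2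
  rw [h2, Pi.zero_apply, QHParams.F, div_mul_eq_mul_div, mul_div_assoc] at h1
  exact nonneg_of_mul_nonneg_right h1 (mul_pos (sub_pos.2 htu) (sub_pos.2 hst))

/-! ### The left endpoint, which may be `0` and lie outside `T` -/

section Endpoint

variable {R V : ℝ}

theorem integral_mul_endpoint (h : IsQuadraticHarness T ℱ X P p)
    (hR : R ∈ T ∨ (R = 0 ∧ Ioo 0 V ⊆ T ∧ ∀ ω, X 0 ω = 0)) (ht : t ∈ T) (hRt : R ≤ t) :
    ∫ ω, X R ω * X t ω ∂P = R := by
  rcases hR with hR | ⟨rfl, -, h0⟩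
  · simpa [hRt] using h.cov R hR t ht
  · simp [h0]

theorem integral_endpoint (h : IsQuadraticHarness T ℱ X P p)
    (hR : R ∈ T ∨ (R = 0 ∧ Ioo 0 V ⊆ T ∧ ∀ ω, X 0 ω = 0)) : ∫ ω, X R ω ∂P = 0 := by
  rcases hR with hR | ⟨rfl, -, h0⟩
  · exact h.mean R hR
  · simp [h0]

theorem integral_mul_self_endpoint (h : IsQuadraticHarness T ℱ X P p)
    (hR : R ∈ T ∨ (R = 0 ∧ Ioo 0 V ⊆ T ∧ ∀ ω, X 0 ω = 0)) : ∫ ω, X R ω * X R ω ∂P = R := by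
  rcases hR with hR | ⟨rfl, -, h0⟩
  · simpa using h.cov R hR R hR
  · simp [h0]

theorem memLp_endpoint [IsProbabilityMeasure P]
    (h : IsQuadraticHarness T ℱ X P p)
    (hR : R ∈ T ∨ (R = 0 ∧ Ioo 0 V ⊆ T ∧ ∀ ω, X 0 ω = 0)) : MemLp (X R) 2 P := by
  rcases hR with hR | ⟨rfl, -, h0⟩
  · exact h.memLp R hR
  · rw [funext h0]; exact memLp_const 0

theorem measurable_endpoint (h : IsQuadraticHarness T ℱ X P p)
    (hR : R ∈ T ∨ (R = 0 ∧ Ioo 0 V ⊆ T ∧ ∀ ω, X 0 ω = 0)) (hs : s ∈ T) (hu : u ∈ T)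
    (hRs : R ≤ s) (hsu : s < u) : Measurable[ℱ s u] (X R) := by
  rcases hR with hR | ⟨rfl, -, h0⟩
  · exact h.measurable s hs u hu hsu R hR (Or.inl hRs)
  · rw [funext h0]; exact measurable_const

theorem Ioo_subset (h : IsQuadraticHarness T ℱ X P p)
    (hR : R ∈ T ∨ (R = 0 ∧ Ioo 0 V ⊆ T ∧ ∀ ω, X 0 ω = 0)) (hV : V ∈ T) : Ioo R V ⊆ T := by
  rcases hR with hR | ⟨rfl, hT, -⟩
  · exact fun t ht => h.mem_of_lt_of_lt hR hV ht.1 ht.2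
  · exact hT

/-- The left endpoint is approached, in time and in `L²`, from within the time interval. -/
theorem exists_seq_endpoint [IsProbabilityMeasure P]
    (h : IsQuadraticHarness T ℱ X P p)
    (hR : R ∈ T ∨ (R = 0 ∧ Ioo 0 V ⊆ T ∧ ∀ ω, X 0 ω = 0)) (hRV : R < V) :
    ∃ s : ℕ → ℝ, (∀ n, s n ∈ T ∧ R ≤ s n ∧ s n < V) ∧ Tendsto s atTop (𝓝 R) ∧
      TendstoInL2 (fun n => X (s n)) (X R) P := by
  have hL := h.memLp_endpoint hR
  rcases hR with hR | ⟨rfl, hT, h0⟩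
  · exact ⟨fun _ => R, fun _ => ⟨hR, le_rfl, hRV⟩, tendsto_const_nhds, TendstoInL2.const hL⟩
  · obtain ⟨s, -, hs, hlim⟩ := exists_seq_strictAnti_tendsto' hRV
    refine ⟨s, fun n => ⟨hT (hs n), (hs n).1.le, (hs n).2⟩, hlim, ?_⟩
    refine tendstoInL2_of_eLpNorm (fun n => h.memLp _ (hT (hs n))) hL ?_
    -- Since `X 0 = 0` and `X (s n)` has second moment `s n`, the distance is the square root of `s
    -- n`.
    have hn : ∀ n, eLpNorm (X (s n) - X 0) 2 P = ENNReal.ofReal (s n ^ (2⁻¹ : ℝ)) := by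
      intro n
      have h0' : X (s n) - X 0 = X (s n) := by funext ω; simp [h0]
      have hc := h.cov _ (hT (hs n)) _ (hT (hs n))
      rw [h0', (h.memLp _ (hT (hs n))).eLpNorm_eq_integral_rpow_norm two_ne_zero
        ENNReal.ofNat_ne_top]
      simp only [min_self] at hc
      simp [sq, hc]
    simp only [hn]
    have := ENNReal.tendsto_ofReal (hlim.rpow_const (p := 2⁻¹) (Or.inr (by norm_num)))
    simpa using this

/-- Nonnegative conditional variances give `K` the sign of `D (s n) V` along times `s n` tending to
`R`. If these denominators are negative infinitely often, `K ≤ 0` in the limit. Otherwise `K ≥ 0` in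
the limit, and its expectation `D R V / (V - R)` is either positive or forces `K = 0` almost
everywhere. Signs pass to the limit through integrals over sets, since the convergence is only in
`L²`. -/
theorem K_nonpos_or_D_pos [IsProbabilityMeasure P]
    (h : IsQuadraticHarness T ℱ X P p)
    (hR : R ∈ T ∨ (R = 0 ∧ Ioo 0 V ⊆ T ∧ ∀ ω, X 0 ω = 0)) (hV : V ∈ T) (hRV : R < V) :
    (∀ᵐ ω ∂P, p.K (slopeΔ R V (X R ω) (X V ω)) (interceptΔ R V (X R ω) (X V ω)) ≤ 0) ∨
      0 < p.D R V := by
  obtain ⟨s, hs, hsR, hL⟩ := h.exists_seq_endpoint hR hRV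
  have hVL := h.memLp V hV
  have hRL := h.memLp_endpoint hR
  have hVc := TendstoInL2.const hVL
  have hint := p.integrable_K (memLp_slopeΔ hRL hVL R V) (memLp_interceptΔ hRL hVL R V)
  have hlim : ∀ A : Set Ω, Tendsto (fun n => ∫ ω in A, p.K (slopeΔ (s n) V (X (s n) ω) (X V ω))
      (interceptΔ (s n) V (X (s n) ω) (X V ω)) ∂P) atTop (𝓝 (∫ ω in A,
      p.K (slopeΔ R V (X R ω) (X V ω)) (interceptΔ R V (X R ω) (X V ω)) ∂P)) := fun A =>
    TendstoInL2.integral_K p ((hL.slopeΔ hVc hsR tendsto_const_nhds hRV).restrict A)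
      ((hL.interceptΔ hVc hsR tendsto_const_nhds hRV).restrict A)
  by_cases hf : ∃ᶠ n in atTop, p.D (s n) V < 0
  · left
    have h0 : 0 ≤ᵐ[P] fun ω =>
        -p.K (slopeΔ R V (X R ω) (X V ω)) (interceptΔ R V (X R ω) (X V ω)) := by
      refine ae_nonneg_of_forall_setIntegral_nonneg hint.neg fun A _ _ => ?_
      rw [integral_neg, neg_nonneg]
      refine le_of_tendsto_of_frequently (hlim A) (hf.mono fun n hn => ?_)
      refine integral_nonpos_of_ae (ae_restrict_of_ae ?_)
      filter_upwards [h.K_div_D_nonneg (hs n).1 hV (hs n).2.2] with ω hω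
      by_contra hc
      exact absurd hω (not_le.2 (div_neg_of_pos_of_neg (not_le.1 hc) hn))
    filter_upwards [h0] with ω hω
    simpa using hω
  · have hf' := not_frequently.1 hf
    have h0 : 0 ≤ᵐ[P] fun ω =>
        p.K (slopeΔ R V (X R ω) (X V ω)) (interceptΔ R V (X R ω) (X V ω)) := by
      refine ae_nonneg_of_forall_setIntegral_nonneg hint fun A _ _ => ?_
      refine ge_of_tendsto (hlim A) (hf'.mono fun n hn => ?_)
      refine integral_nonneg_of_ae (ae_restrict_of_ae ?_)
      have hpos : 0 < p.D (s n) V :=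
        lt_of_le_of_ne (not_lt.1 hn) (h.D_ne_zero (hs n).1 hV (hs n).2.2).symm
      filter_upwards [h.K_div_D_nonneg (hs n).1 hV (hs n).2.2] with ω hω
      by_contra hc
      exact absurd hω (not_le.2 (div_neg_of_neg_of_pos (not_le.1 hc) hpos))
    have hI := integral_K_of_cov p hRL hVL hRV (h.integral_endpoint hR) (h.mean V hV)
      (h.integral_mul_self_endpoint hR) (h.integral_mul_endpoint hR hV hRV.le)
      (by simpa using h.cov V hV V hV)
    have hsub := sub_pos.2 hRV
    by_cases hD : 0 < p.D R V
    · exact Or.inr hD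
    · left
      have h1 : ∫ ω, p.K (slopeΔ R V (X R ω) (X V ω)) (interceptΔ R V (X R ω) (X V ω)) ∂P = 0 :=
        le_antisymm (hI ▸ div_nonpos_of_nonpos_of_nonneg (not_lt.1 hD) hsub.le)
          (integral_nonneg_of_ae h0)
      filter_upwards [(integral_eq_zero_iff_of_nonneg_ae h0 hint).1 h1] with ω hω
      exact hω.le

/-- There may be no usable field `ℱ R V`. But `(X R, X V)` is measurable for each `ℱ (s n) V`, so
the identities hold with `s n` in place of `R` on the same event, and `n → ∞` gives the claim. -/
theorem setIntegral_endpoint [IsProbabilityMeasure P]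
    (h : IsQuadraticHarness T ℱ X P p)
    (hR : R ∈ T ∨ (R = 0 ∧ Ioo 0 V ⊆ T ∧ ∀ ω, X 0 ω = 0)) (hV : V ∈ T) (ht : t ∈ Ioo R V)
    {B : Set (ℝ × ℝ)} (hB : MeasurableSet B) :
    ∫ ω in (fun ω => (X R ω, X V ω)) ⁻¹' B, X t ω ∂P =
      ∫ ω in (fun ω => (X R ω, X V ω)) ⁻¹' B, linInterp R t V (X R ω) (X V ω) ∂P ∧
    (p.D R V ≠ 0 → ∫ ω in (fun ω => (X R ω, X V ω)) ⁻¹' B, X t ω ^ 2 ∂P =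
      ∫ ω in (fun ω => (X R ω, X V ω)) ⁻¹' B, p.condSq R t V (X R ω) (X V ω) ∂P) := by
  have hRV := ht.1.trans ht.2
  obtain ⟨s, hs, hsR, hL⟩ := h.exists_seq_endpoint hR hRV
  have hVc := TendstoInL2.const (h.memLp V hV)
  set A := (fun ω => (X R ω, X V ω)) ⁻¹' B
  have htT := h.Ioo_subset hR hV ht
  have hA : ∀ n, MeasurableSet[ℱ (s n) V] A := fun n =>
    ((h.measurable_endpoint hR (hs n).1 hV (hs n).2.1 (hs n).2.2).prodMk
      (h.measurable _ (hs n).1 _ hV (hs n).2.2 V hV (Or.inr le_rfl))) hB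
  have key : ∀ (n : ℕ) {f g : Ω → ℝ}, Integrable f P → P[f | ℱ (s n) V] =ᵐ[P] g →
      ∫ ω in A, f ω ∂P = ∫ ω in A, g ω ∂P := fun n f g hf hfg => by
    have hle := h.le _ (hs n).1 _ hV (hs n).2.2
    rw [← setIntegral_condExp hle hf (hA n)]
    exact setIntegral_congr_ae (hle _ (hA n)) (hfg.mono fun _ h _ => h)
  have hev : ∀ᶠ n in atTop, s n < t := hsR.eventually_lt_const ht.1
  have htL := h.memLp t htT
  refine ⟨?_, fun hD => ?_⟩
  · refine tendsto_nhds_unique_of_eventuallyEq tendsto_const_nhds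
      ((hL.linInterp hVc hsR tendsto_const_nhds tendsto_const_nhds hRV).restrict A).integral
      (hev.mono fun n hn => ?_)
    exact key n (htL.integrable one_le_two) (h.condMean _ (hs n).1 t htT V hV hn ht.2)
  · refine tendsto_nhds_unique_of_eventuallyEq tendsto_const_nhds
      (TendstoInL2.integral_condSq p (hL.restrict A) (hVc.restrict A) hsR tendsto_const_nhds
        tendsto_const_nhds hRV hD) (hev.mono fun n hn => ?_)
    exact key n htL.integrable_sq (h.condExp_sq (hs n).1 htT hV hn ht.2)

end Endpoint

end IsQuadraticHarness

/-! ### Fields generated by the process, and rational approximation of times -/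

section TimeSigma

variable {Ω : Type*}

/-- The σ-field generated by the values of `X` at the times in `S`. -/
abbrev timeSigma (X : ℝ → Ω → ℝ) (S : Set ℝ) : MeasurableSpace Ω :=
  MeasurableSpace.comap (fun ω (r : S) => X r ω) inferInstance

theorem measurable_timeSigma (X : ℝ → Ω → ℝ) {S : Set ℝ} {r : ℝ} (hr : r ∈ S) :
    Measurable[timeSigma X S] (X r) := by
  have h : Measurable[timeSigma X S] fun ω (r : S) => X r ω := comap_measurable _
  exact (measurable_pi_apply (⟨r, hr⟩ : S)).comp h

theorem timeSigma_le {m : MeasurableSpace Ω} {X : ℝ → Ω → ℝ} {S : Set ℝ}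
    (h : ∀ r ∈ S, Measurable[m] (X r)) : timeSigma X S ≤ m :=
  (measurable_pi_iff.2 fun r : S => h r r.2).comap_le

theorem countablyGenerated_timeSigma (X : ℝ → Ω → ℝ) {S : Set ℝ} (hS : S.Countable) :
    @MeasurableSpace.CountablyGenerated Ω (timeSigma X S) := by
  have := hS.to_subtype
  exact MeasurableSpace.CountablyGenerated.comap _

end TimeSigma

theorem measurable_eventually_of_ae_tendsto {Ω : Type*} {G : MeasurableSpace Ω}
    [mΩ : MeasurableSpace Ω] {Q : Measure Ω} {f : ℕ → Ω → ℝ} {g : Ω → ℝ}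
    (hf : ∀ n, Measurable[G] (f n))
    (h : ∀ᵐ ω ∂Q, Tendsto (fun n => f n ω) atTop (𝓝 (g ω))) :
    Measurable[eventuallyMeasurableSpace G (ae Q)] g := by
  -- The limsup is measurable for `G` itself and agrees with `g` off a null set.
  have hmeas : Measurable[G] fun ω => limsup (fun n => f n ω) atTop := Measurable.limsup hf
  exact hmeas.eventuallyMeasurable_of_eventuallyEq (h.mono fun ω hω => hω.limsup_eq.symm)

section RatSeq

variable {R V t : ℝ}

theorem exists_rat_seq_gt (ht : t ∈ Ico R V) : ∃ q : ℕ → ℝ,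
    (∀ n, q n ∈ Ioo t V ∩ range ((↑) : ℚ → ℝ)) ∧ Tendsto q atTop (𝓝 t) := by
  obtain ⟨q, -, hq, hlim⟩ := Real.exists_seq_rat_strictAnti_tendsto t
  obtain ⟨N, hN⟩ := eventually_atTop.1 (hlim.eventually_lt_const ht.2)
  exact ⟨fun n => q (n + N), fun n => ⟨⟨hq _, hN _ (Nat.le_add_left _ _)⟩, mem_range_self _⟩,
    hlim.comp (tendsto_add_atTop_nat N)⟩

theorem exists_rat_seq_lt (ht : t ∈ Ioc R V) : ∃ q : ℕ → ℝ,
    (∀ n, q n ∈ Ioo R t ∩ range ((↑) : ℚ → ℝ)) ∧ Tendsto q atTop (𝓝 t) := by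
  obtain ⟨q, -, hq, hlim⟩ := Real.exists_seq_rat_strictMono_tendsto t
  obtain ⟨N, hN⟩ := eventually_atTop.1 (hlim.eventually_const_lt ht.1)
  exact ⟨fun n => q (n + N), fun n => ⟨⟨hN _ (Nat.le_add_left _ _), hq _⟩, mem_range_self _⟩,
    hlim.comp (tendsto_add_atTop_nat N)⟩

end RatSeq

/-! ### The law of the bridge: `L²` continuity of its paths in time -/

section BridgeLaw

variable {Ω : Type*} [mΩ : MeasurableSpace Ω]

/-- The first two moments and conditional moments, at the times in `J`, of a bridge from `(R, a)`
to `(V, b)` in a quadratic harness with parameters `p`. -/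
structure BridgeLaw (J : Set ℝ) (X : ℝ → Ω → ℝ) (Q : Measure Ω) (p : QHParams)
    (R V a b m : ℝ) : Prop where
  memLp : ∀ t ∈ J, MemLp (X t) 2 Q
  mean : ∀ t ∈ J, ∫ ω, X t ω ∂Q = linInterp R t V a b
  cov : ∀ s ∈ J, ∀ t ∈ J, ∫ ω, X s ω * X t ω ∂Q =
    linInterp R s V a b * linInterp R t V a b + m * ((V - max s t) * (min s t - R))
  setIntegral : ∀ s ∈ J, ∀ t ∈ J, ∀ u ∈ J, s < t → t < u → ∀ A,
    MeasurableSet[timeSigma X (J ∩ {r | r ≤ s ∨ u ≤ r})] A →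
    ∫ ω in A, X t ω ∂Q = ∫ ω in A, linInterp s t u (X s ω) (X u ω) ∂Q
  setIntegral_sq : ∀ s ∈ J, ∀ t ∈ J, ∀ u ∈ J, s < t → t < u → ∀ A,
    MeasurableSet[timeSigma X (J ∩ {r | r ≤ s ∨ u ≤ r})] A →
    ∫ ω in A, X t ω ^ 2 ∂Q = ∫ ω in A, p.condSq s t u (X s ω) (X u ω) ∂Q

namespace BridgeLaw

variable {J : Set ℝ} {X : ℝ → Ω → ℝ} {Q : Measure Ω} {p : QHParams} {R V a b m : ℝ}

/-- With `d = |t - s|`, the mean contributes `(slope * d) ^ 2` and the bridge covariance `m * d * (V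
- R - d)`. Both are linearly bounded because `d ≤ V - R`. -/
theorem integral_sub_sq_le [IsProbabilityMeasure Q] (h : BridgeLaw J X Q p R V a b m)
    (hJ : J ⊆ Ioo R V) (hm : 0 ≤ m) {s t : ℝ} (hs : s ∈ J) (ht : t ∈ J) :
    ∫ ω, (X t ω - X s ω) ^ 2 ∂Q ≤ (slopeΔ R V a b ^ 2 + m) * (V - R) * |t - s| := by
  wlog hst : s ≤ t generalizing s t
  · rw [abs_sub_comm]
    convert this ht hs (le_of_not_ge hst) using 3
    exact sub_sq_comm _ _
  have h1 := integral_linear_mul (h.memLp t ht) (h.memLp s hs) 1 (-1) 1 (-1)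
  rw [h.cov t ht t ht, h.cov t ht s hs, h.cov s hs s hs, max_self, max_self, min_self, min_self,
    max_eq_left hst, min_eq_right hst] at h1
  obtain ⟨hs1, -⟩ := hJ hs
  obtain ⟨-, ht2⟩ := hJ ht
  have hne : V - R ≠ 0 := by linarith
  have h2 : linInterp R t V a b - linInterp R s V a b = slopeΔ R V a b * (t - s) := by
    rw [linInterp, linInterp, slopeΔ]
    field_simp
    ring
  have h3 : ∫ ω, (X t ω - X s ω) ^ 2 ∂Q = (slopeΔ R V a b * (t - s)) ^ 2 +
      m * ((t - s) * ((V - R) - (t - s))) := by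
    rw [← h2]
    calc ∫ ω, (X t ω - X s ω) ^ 2 ∂Q
        = ∫ ω, (1 * X t ω + -1 * X s ω) * (1 * X t ω + -1 * X s ω) ∂Q :=
          integral_congr_ae (ae_of_all _ fun ω => by ring)
      _ = _ := by rw [h1]; ring
  rw [h3, abs_of_nonneg (sub_nonneg.2 hst)]
  have hd : 0 ≤ t - s := sub_nonneg.2 hst
  have hVR : t - s ≤ V - R := by linarith
  nlinarith [mul_nonneg hm (mul_nonneg hd hd),
    mul_nonneg (mul_nonneg (sq_nonneg (slopeΔ R V a b)) hd) (sub_nonneg.2 hVR)]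

theorem eLpNorm_sub_le [IsProbabilityMeasure Q] (h : BridgeLaw J X Q p R V a b m)
    (hJ : J ⊆ Ioo R V) (hm : 0 ≤ m) {s t : ℝ} (hs : s ∈ J) (ht : t ∈ J) :
    eLpNorm (X t - X s) 2 Q ≤
      ENNReal.ofReal (((slopeΔ R V a b ^ 2 + m) * (V - R) * |t - s|) ^ (2⁻¹ : ℝ)) := by
  rw [((h.memLp t ht).sub (h.memLp s hs)).eLpNorm_eq_integral_rpow_norm two_ne_zero
    ENNReal.ofNat_ne_top]
  refine ENNReal.ofReal_le_ofReal ?_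
  have h1 : ∫ ω, ‖(X t - X s) ω‖ ^ (2 : ℝ≥0∞).toReal ∂Q = ∫ ω, (X t ω - X s ω) ^ 2 ∂Q := by
    simp
  rw [h1, ENNReal.toReal_ofNat]
  exact Real.rpow_le_rpow (integral_nonneg fun ω => sq_nonneg _)
    (h.integral_sub_sq_le hJ hm hs ht) (by norm_num)

/-! ### From rational times to all times -/

section Extension

variable (h : BridgeLaw (Ioo R V ∩ range ((↑) : ℚ → ℝ)) X Q p R V a b m)
  (hrc : ∀ᵐ ω ∂Q, ∀ t ∈ Ioo R V, ContinuousWithinAt (fun r => X r ω) (Ici t) t)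

include hrc in
theorem ae_tendsto_of_rightContinuous {t : ℝ} (ht : t ∈ Ioo R V) {q : ℕ → ℝ}
    (hq : ∀ n, t ≤ q n) (hlim : Tendsto q atTop (𝓝 t)) :
    ∀ᵐ ω ∂Q, Tendsto (fun n => X (q n) ω) atTop (𝓝 (X t ω)) := by
  filter_upwards [hrc] with ω hω
  exact (hω t ht).tendsto.comp (tendsto_nhdsWithin_iff.2 ⟨hlim, Eventually.of_forall hq⟩)

-- Right-continuity gives almost sure convergence along rationals from above, and Fatou's lemma
-- carries the increment bound to the limit.
include h hrc in
theorem eLpNorm_sub_le_of_rightContinuous [IsProbabilityMeasure Q] (hm : 0 ≤ m)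
    {s t : ℝ} (hs : s ∈ Ioo R V) (ht : t ∈ Ioo R V) :
    eLpNorm (X t - X s) 2 Q ≤
      ENNReal.ofReal (((slopeΔ R V a b ^ 2 + m) * (V - R) * |t - s|) ^ (2⁻¹ : ℝ)) := by
  obtain ⟨q, hq, hqs⟩ := exists_rat_seq_gt (Ioo_subset_Ico_self hs)
  obtain ⟨r, hr, hrt⟩ := exists_rat_seq_gt (Ioo_subset_Ico_self ht)
  have hqJ : ∀ n, q n ∈ Ioo R V ∩ range ((↑) : ℚ → ℝ) := fun n =>
    ⟨⟨hs.1.trans (hq n).1.1, (hq n).1.2⟩, (hq n).2⟩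
  have hrJ : ∀ n, r n ∈ Ioo R V ∩ range ((↑) : ℚ → ℝ) := fun n =>
    ⟨⟨ht.1.trans (hr n).1.1, (hr n).1.2⟩, (hr n).2⟩
  have hae : ∀ᵐ ω ∂Q, Tendsto (fun n => (X (r n) - X (q n)) ω) atTop (𝓝 ((X t - X s) ω)) := by
    filter_upwards [ae_tendsto_of_rightContinuous hrc hs (fun n => (hq n).1.1.le) hqs,
      ae_tendsto_of_rightContinuous hrc ht (fun n => (hr n).1.1.le) hrt] with ω h1 h2
    exact h2.sub h1
  refine (Lp.eLpNorm_lim_le_liminf_eLpNorm (fun n =>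
    ((h.memLp _ (hrJ n)).sub (h.memLp _ (hqJ n))).1) _ hae).trans ?_
  refine (liminf_le_liminf (Eventually.of_forall fun n =>
    h.eLpNorm_sub_le inter_subset_left hm (hqJ n) (hrJ n))).trans (le_of_eq ?_)
  refine Tendsto.liminf_eq (ENNReal.tendsto_ofReal ?_)
  exact (((hrt.sub hqs).abs).const_mul _).rpow_const (Or.inr (by norm_num))

include h hrc in
theorem memLp_of_rightContinuous [IsProbabilityMeasure Q]
    (hX : ∀ t ∈ Ioo R V, Measurable (X t)) (hm : 0 ≤ m) {t : ℝ} (ht : t ∈ Ioo R V) :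
    MemLp (X t) 2 Q := by
  obtain ⟨q, hq, -⟩ := exists_rat_seq_gt (Ioo_subset_Ico_self ht)
  have hqV : q 0 ∈ Ioo R V := ⟨ht.1.trans (hq 0).1.1, (hq 0).1.2⟩
  have h1 : MemLp (X t - X (q 0)) 2 Q := ⟨((hX t ht).sub (hX _ hqV)).aestronglyMeasurable,
    (h.eLpNorm_sub_le_of_rightContinuous hrc hm hqV ht).trans_lt ENNReal.ofReal_lt_top⟩
  simpa using h1.add (h.memLp _ ⟨hqV, (hq 0).2⟩)

-- Paths are continuous only from the right, but the increment bound is symmetric in time, so `q`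
-- may approach `t` from either side.
include h hrc in
theorem tendstoInL2_of_rightContinuous [IsProbabilityMeasure Q]
    (hX : ∀ t ∈ Ioo R V, Measurable (X t)) (hm : 0 ≤ m) {t : ℝ} (ht : t ∈ Ioo R V)
    {q : ℕ → ℝ} (hq : ∀ n, q n ∈ Ioo R V) (hlim : Tendsto q atTop (𝓝 t)) :
    TendstoInL2 (fun n => X (q n)) (X t) Q := by
  refine tendstoInL2_of_eLpNorm (fun n => h.memLp_of_rightContinuous hrc hX hm (hq n))
    (h.memLp_of_rightContinuous hrc hX hm ht) ?_
  refine tendsto_of_tendsto_of_tendsto_of_le_of_le tendsto_const_nhds ?_ (fun _ => zero_le)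
    (fun n => h.eLpNorm_sub_le_of_rightContinuous hrc hm ht (hq n))
  have h1 : Tendsto (fun n => |q n - t|) atTop (𝓝 0) := by
    simpa using (hlim.sub_const t).abs
  have h2 := (h1.const_mul ((slopeΔ R V a b ^ 2 + m) * (V - R))).rpow_const (p := 2⁻¹)
    (Or.inr (by norm_num))
  simpa using ENNReal.tendsto_ofReal h2

include hrc in
/-- Up to null sets, the values at all times outside `(s, u)` are functions of the values at
rational times outside a smaller interval. -/
theorem exists_ae_eq_measurableSet_rat {s u s' u' : ℝ} (hs : s < s') (hu : u' < u) {A : Set Ω}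
    (hA : MeasurableSet[timeSigma X (Ioo R V ∩ {r | r ≤ s ∨ u ≤ r})] A) :
    ∃ A', MeasurableSet[timeSigma X
      ((Ioo R V ∩ range ((↑) : ℚ → ℝ)) ∩ {r | r ≤ s' ∨ u' ≤ r})] A' ∧ A =ᵐ[Q] A' := by
  suffices hle : timeSigma X (Ioo R V ∩ {r | r ≤ s ∨ u ≤ r}) ≤
      eventuallyMeasurableSpace (timeSigma X
        ((Ioo R V ∩ range ((↑) : ℚ → ℝ)) ∩ {r | r ≤ s' ∨ u' ≤ r})) (ae Q) from hle A hA
  refine timeSigma_le fun t ⟨ht, htsu⟩ => ?_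
  -- Times are approached from the right. For `t ≤ s` the gap between `s` and `s'` leaves room for
  -- this; for `u ≤ t` the approximants stay beyond `u'` automatically.
  have hseq : ∃ q : ℕ → ℝ, (∀ n, t < q n) ∧ Tendsto q atTop (𝓝 t) ∧
      ∀ n, q n ∈ (Ioo R V ∩ range ((↑) : ℚ → ℝ)) ∩ {r | r ≤ s' ∨ u' ≤ r} := by
    rcases htsu with hts | hut
    · obtain ⟨q, hq, hlim⟩ := exists_rat_seq_gt (V := min V s')
        (⟨ht.1.le, lt_min ht.2 (lt_of_le_of_lt hts hs)⟩ : t ∈ Ico R (min V s'))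
      exact ⟨q, fun n => (hq n).1.1, hlim, fun n => ⟨⟨⟨ht.1.trans (hq n).1.1,
        (hq n).1.2.trans_le (min_le_left _ _)⟩, (hq n).2⟩,
        Or.inl ((hq n).1.2.le.trans (min_le_right _ _))⟩⟩
    · obtain ⟨q, hq, hlim⟩ := exists_rat_seq_gt (Ioo_subset_Ico_self ht)
      exact ⟨q, fun n => (hq n).1.1, hlim, fun n => ⟨⟨⟨ht.1.trans (hq n).1.1, (hq n).1.2⟩,
        (hq n).2⟩, Or.inr ((hu.le.trans hut).trans (hq n).1.1.le)⟩⟩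
  obtain ⟨q, hq, hlim, hqS⟩ := hseq
  exact measurable_eventually_of_ae_tendsto (fun n => measurable_timeSigma X (hqS n))
    (ae_tendsto_of_rightContinuous hrc ht (fun n => (hq n).le) hlim)

include h hrc in
/-- Right-continuity extends the moments of a bridge from rational to all times. -/
theorem of_rightContinuous [IsProbabilityMeasure Q] (hX : ∀ t ∈ Ioo R V, Measurable (X t))
    (hm : 0 ≤ m) (hD : ∀ s ∈ Ioo R V, ∀ u ∈ Ioo R V, s < u → p.D s u ≠ 0) :
    BridgeLaw (Ioo R V) X Q p R V a b m := by
  have hlin : ∀ {q : ℕ → ℝ} {t : ℝ}, Tendsto q atTop (𝓝 t) →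
      Tendsto (fun n => linInterp R (q n) V a b) atTop (𝓝 (linInterp R t V a b)) := fun hq =>
    ((hq.const_sub V).div_const _ |>.mul_const a).add
      ((hq.sub_const R).div_const _ |>.mul_const b)
  have hgt : ∀ t ∈ Ioo R V, ∃ q : ℕ → ℝ, (∀ n, q n ∈ Ioo R V ∩ range ((↑) : ℚ → ℝ)) ∧
      (∀ n, t < q n) ∧ Tendsto q atTop (𝓝 t) := fun t ht => by
    obtain ⟨q, hq, hlim⟩ := exists_rat_seq_gt (Ioo_subset_Ico_self ht)
    exact ⟨q, fun n => ⟨⟨ht.1.trans (hq n).1.1, (hq n).1.2⟩, (hq n).2⟩, fun n => (hq n).1.1,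
      hlim⟩
  have hlt : ∀ t ∈ Ioo R V, ∃ q : ℕ → ℝ, (∀ n, q n ∈ Ioo R V ∩ range ((↑) : ℚ → ℝ)) ∧
      (∀ n, q n < t) ∧ Tendsto q atTop (𝓝 t) := fun t ht => by
    obtain ⟨q, hq, hlim⟩ := exists_rat_seq_lt (Ioo_subset_Ioc_self ht)
    exact ⟨q, fun n => ⟨⟨(hq n).1.1, (hq n).1.2.trans ht.2⟩, (hq n).2⟩, fun n => (hq n).1.2,
      hlim⟩
  have hconv := fun {t : ℝ} (ht : t ∈ Ioo R V) {q : ℕ → ℝ} (hq : ∀ n, q n ∈ Ioo R V)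
    (hlim : Tendsto q atTop (𝓝 t)) => h.tendstoInL2_of_rightContinuous hrc hX hm ht hq hlim
  refine ⟨fun t ht => h.memLp_of_rightContinuous hrc hX hm ht, ?_, ?_, ?_, ?_⟩
  · intro t ht
    obtain ⟨q, hq, -, hlim⟩ := hgt t ht
    refine tendsto_nhds_unique (hconv ht (fun n => (hq n).1) hlim).integral ?_
    simp only [fun n => h.mean _ (hq n)]
    exact hlin hlim
  · intro s hs t ht
    obtain ⟨q, hq, -, hqs⟩ := hgt s hs
    obtain ⟨r, hr, -, hrt⟩ := hgt t ht
    refine tendsto_nhds_unique ((hconv hs (fun n => (hq n).1) hqs).integral_mul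
      (hconv ht (fun n => (hr n).1) hrt)) ?_
    simp only [fun n => h.cov _ (hq n) _ (hr n)]
    exact ((hlin hqs).mul (hlin hrt)).add
      ((((hqs.max hrt).const_sub V).mul ((hqs.min hrt).sub_const R)).const_mul m)
  all_goals
    intro s hs t ht u hu hst htu A hA
    -- The rational interval shrinks strictly: `s'` decreases to `s` and `u'` increases to `u`. Then
    -- `A` agrees, up to a null set, with an event from rational times outside `(s', u')`, where the
    -- hypothesis applies.
    obtain ⟨s', hsJ, hs', hslim⟩ := hgt s hs
    obtain ⟨t', htJ, -, htlim⟩ := hgt t ht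
    obtain ⟨u', huJ, hu', hulim⟩ := hlt u hu
    have hsL := (hconv hs (fun n => (hsJ n).1) hslim).restrict A
    have htL := (hconv ht (fun n => (htJ n).1) htlim).restrict A
    have huL := (hconv hu (fun n => (huJ n).1) hulim).restrict A
    choose A' hA' hAA' using fun n => exists_ae_eq_measurableSet_rat hrc (hs' n) (hu' n) hA
    have hev := (hslim.eventually_lt htlim hst).and (htlim.eventually_lt hulim htu)
  · refine tendsto_nhds_unique_of_eventuallyEq htL.integral
      (hsL.linInterp huL hslim htlim hulim (hst.trans htu)).integral (hev.mono fun n hn => ?_)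
    dsimp only
    rw [setIntegral_congr_set (hAA' n), setIntegral_congr_set (hAA' n)]
    exact h.setIntegral _ (hsJ n) _ (htJ n) _ (huJ n) hn.1 hn.2 _ (hA' n)
  · have h1 := htL.integral_mul htL
    simp only [← sq] at h1
    refine tendsto_nhds_unique_of_eventuallyEq h1 (TendstoInL2.integral_condSq p hsL huL hslim
      htlim hulim (hst.trans htu) (hD s hs u hu (hst.trans htu))) (hev.mono fun n hn => ?_)
    dsimp only
    rw [setIntegral_congr_set (hAA' n), setIntegral_congr_set (hAA' n)]
    exact h.setIntegral_sq _ (hsJ n) _ (htJ n) _ (huJ n) hn.1 hn.2 _ (hA' n)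

end Extension

end BridgeLaw

/-- Countability of the rational times lets one null set of `z` cover all of them. The endpoint
identities give the mean and variance, and the interpolation between `s` and `V` gives the
covariances. -/
theorem IsQuadraticHarness.ae_bridgeLaw_rat {P : Measure Ω} [IsProbabilityMeasure P] {T : Set ℝ}
    {ℱ : ℝ → ℝ → MeasurableSpace Ω} {X : ℝ → Ω → ℝ} {p : QHParams}
    (h : IsQuadraticHarness T ℱ X P p) {R V : ℝ} (hV : V ∈ T) (hRV : R < V)
    (hR : R ∈ T ∨ (R = 0 ∧ Ioo 0 V ⊆ T ∧ ∀ ω, X 0 ω = 0)) (hD : p.D R V ≠ 0)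
    {κ : Kernel (ℝ × ℝ) Ω} [IsMarkovKernel κ]
    (hκ : (P.map fun ω => (X R ω, X V ω)) ⊗ₘ κ = P.map fun ω => ((X R ω, X V ω), ω)) :
    ∀ᵐ z ∂(P.map fun ω => (X R ω, X V ω)),
      BridgeLaw (Ioo R V ∩ range ((↑) : ℚ → ℝ)) X (κ z) p R V z.1 z.2
        (p.bridgeK R V z / p.D R V) := by
  set J := Ioo R V ∩ range ((↑) : ℚ → ℝ)
  have hJT : ∀ t ∈ J, t ∈ T := fun t ht => h.Ioo_subset hR hV ht.1
  have hJc : J.Countable := (countable_range _).mono inter_subset_right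
  have hWF : ∀ s ∈ T, ∀ u ∈ T, R ≤ s → s < u → u ≤ V →
      Measurable[ℱ s u] fun ω => (X R ω, X V ω) := fun s hs u hu hRs hsu huV =>
    (h.measurable_endpoint hR hs hu hRs hsu).prodMk (h.measurable s hs u hu hsu V hV (Or.inr huV))
  have hW : Measurable fun ω => (X R ω, X V ω) := by
    obtain ⟨s, hs, -⟩ := h.exists_seq_endpoint hR hRV
    exact (hWF _ (hs 0).1 V hV (hs 0).2.1 (hs 0).2.2 le_rfl).mono
      (h.le _ (hs 0).1 V hV (hs 0).2.2) le_rfl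
  have hRL := h.memLp_endpoint hR
  have hVL := h.memLp V hV
  have h0 := ae_ae_eq_of_disintegration hW hκ
  have h1 : ∀ᵐ z ∂(P.map fun ω => (X R ω, X V ω)), ∀ t ∈ J, MemLp (X t) 2 (κ z) :=
    (ae_ball_iff hJc).2 fun t ht => ae_memLp_two_of_disintegration hW hκ
      (h.measurable_apply (hJT t ht)) (h.memLp t (hJT t ht))
  have h2 : ∀ᵐ z ∂(P.map fun ω => (X R ω, X V ω)), ∀ t ∈ J,
      ∫ ω, X t ω ∂(κ z) = ∫ ω, linInterp R t V (X R ω) (X V ω) ∂(κ z) :=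
    (ae_ball_iff hJc).2 fun t ht => ae_integral_eq_of_disintegration hW hκ
      ((h.memLp t (hJT t ht)).integrable one_le_two)
      ((memLp_linInterp hRL hVL R t V).integrable one_le_two)
      fun B hB => (h.setIntegral_endpoint hR hV ht.1 hB).1
  have h3 : ∀ᵐ z ∂(P.map fun ω => (X R ω, X V ω)), ∀ t ∈ J,
      ∫ ω, X t ω ^ 2 ∂(κ z) = ∫ ω, p.condSq R t V (X R ω) (X V ω) ∂(κ z) :=
    (ae_ball_iff hJc).2 fun t ht => ae_integral_eq_of_disintegration hW hκ
      (h.memLp t (hJT t ht)).integrable_sq (integrable_condSq hRL hVL p R t V)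
      fun B hB => (h.setIntegral_endpoint hR hV ht.1 hB).2 hD
  have h4 : ∀ᵐ z ∂(P.map fun ω => (X R ω, X V ω)), ∀ s ∈ J, ∀ t ∈ J, s < t →
      ∫ ω, X s ω * X t ω ∂(κ z) = ∫ ω, X s ω * linInterp s t V (X s ω) (X V ω) ∂(κ z) := by
    refine (ae_ball_iff hJc).2 fun s hs => (ae_ball_iff hJc).2 fun t ht => ?_
    rw [ae_all_iff]
    intro hst
    have hsV := hs.1.2
    refine ae_integral_eq_of_condExp (h.le s (hJT s hs) V hV hsV) hW
      (hWF s (hJT s hs) V hV hs.1.1.le hsV le_rfl) hκ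
      ((h.memLp s (hJT s hs)).integrable_mul (h.memLp t (hJT t ht))) ?_
    have hc := condExp_mul_of_stronglyMeasurable_left (m := ℱ s V) (μ := P) (f := X s) (g := X t)
      (h.measurable s (hJT s hs) V hV hsV s (hJT s hs) (Or.inl le_rfl)).stronglyMeasurable
      ((h.memLp s (hJT s hs)).integrable_mul (h.memLp t (hJT t ht)))
      ((h.memLp t (hJT t ht)).integrable one_le_two)
    filter_upwards [hc, h.condMean s (hJT s hs) t (hJT t ht) V hV hst ht.1.2] with ω e1 e2
    change P[X s * X t | ℱ s V] ω = _
    rw [e1, Pi.mul_apply, e2, linInterp]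
  -- The given field `ℱ s u` is replaced by the one generated by rational times outside `(s, u)`,
  -- which is countably generated.
  have hcore : ∀ {s u : ℝ}, s ∈ J → u ∈ J → s < u → ∀ {f g : Ω → ℝ}, Integrable f P →
      P[f | ℱ s u] =ᵐ[P] g → ∀ᵐ z ∂(P.map fun ω => (X R ω, X V ω)), ∀ A,
        MeasurableSet[timeSigma X (J ∩ {r | r ≤ s ∨ u ≤ r})] A →
        ∫ ω in A, f ω ∂(κ z) = ∫ ω in A, g ω ∂(κ z) := by
    intro s u hs hu hsu f g hf hfg
    exact ae_forall_setIntegral_eq_of_condExp (h.le s (hJT s hs) u (hJT u hu) hsu)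
      (timeSigma_le fun r hr => h.measurable s (hJT s hs) u (hJT u hu) hsu r (hJT r hr.1) hr.2)
      (countablyGenerated_timeSigma X (hJc.mono inter_subset_left)) hW
      (hWF s (hJT s hs) u (hJT u hu) hs.1.1.le hsu hu.1.2.le) hκ hf hfg
  have h5 : ∀ᵐ z ∂(P.map fun ω => (X R ω, X V ω)), ∀ s ∈ J, ∀ t ∈ J, ∀ u ∈ J, s < t → t < u →
      ∀ A, MeasurableSet[timeSigma X (J ∩ {r | r ≤ s ∨ u ≤ r})] A →
      ∫ ω in A, X t ω ∂(κ z) = ∫ ω in A, linInterp s t u (X s ω) (X u ω) ∂(κ z) := by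
    refine (ae_ball_iff hJc).2 fun s hs => (ae_ball_iff hJc).2 fun t ht =>
      (ae_ball_iff hJc).2 fun u hu => ?_
    simp only [ae_all_iff (ι := _ < _)]
    exact fun hst htu => hcore hs hu (hst.trans htu)
      ((h.memLp t (hJT t ht)).integrable one_le_two)
      (h.condMean s (hJT s hs) t (hJT t ht) u (hJT u hu) hst htu)
  have h6 : ∀ᵐ z ∂(P.map fun ω => (X R ω, X V ω)), ∀ s ∈ J, ∀ t ∈ J, ∀ u ∈ J, s < t → t < u →
      ∀ A, MeasurableSet[timeSigma X (J ∩ {r | r ≤ s ∨ u ≤ r})] A →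
      ∫ ω in A, X t ω ^ 2 ∂(κ z) = ∫ ω in A, p.condSq s t u (X s ω) (X u ω) ∂(κ z) := by
    refine (ae_ball_iff hJc).2 fun s hs => (ae_ball_iff hJc).2 fun t ht =>
      (ae_ball_iff hJc).2 fun u hu => ?_
    simp only [ae_all_iff (ι := _ < _)]
    exact fun hst htu => hcore hs hu (hst.trans htu) (h.memLp t (hJT t ht)).integrable_sq
      (h.condExp_sq (hJT s hs) (hJT t ht) (hJT u hu) hst htu)
  filter_upwards [h0, h1, h2, h3, h4, h5, h6] with z hz0 hz1 hz2 hz3 hz4 hz5 hz6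
  have hmean : ∀ t ∈ J, ∫ ω, X t ω ∂(κ z) = linInterp R t V z.1 z.2 := fun t ht => by
    rw [hz2 t ht, integral_congr_ae (g := fun _ => linInterp R t V z.1 z.2)
      (hz0.mono fun ω hω => by simp only [← hω])]
    simp
  have hsq : ∀ t ∈ J, ∫ ω, X t ω * X t ω ∂(κ z) =
      linInterp R t V z.1 z.2 ^ 2 + p.F t R V * p.bridgeK R V z := fun t ht => by
    simp only [← sq]
    rw [hz3 t ht, integral_congr_ae (g := fun _ => p.condSq R t V z.1 z.2)
      (hz0.mono fun ω hω => by simp only [← hω])]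
    simp [QHParams.condSq, QHParams.bridgeK]
  refine ⟨hz1, hmean, fun s hs t ht => ?_, hz5, hz6⟩
  wlog hst : s ≤ t generalizing s t
  · rw [max_comm, min_comm, mul_comm (linInterp R s V z.1 z.2)]
    simpa only [mul_comm] using this t ht s hs (le_of_not_ge hst)
  rcases hst.eq_or_lt with rfl | hst
  · rw [hsq s hs, QHParams.F, max_self, min_self]
    ring
  · have hVs : V - s ≠ 0 := (sub_pos.2 hs.1.2).ne'
    have hVR : V - R ≠ 0 := (sub_pos.2 hRV).ne'
    -- Under `κ z` the endpoint `X V` is the constant `z.2`, so the mixed moment reduces to the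
    -- first two moments of `X s`.
    have e1 : ∫ ω, X s ω * linInterp s t V (X s ω) (X V ω) ∂(κ z) =
        ∫ ω, ((V - t) / (V - s) * (X s ω * X s ω) + (t - s) / (V - s) * z.2 * X s ω) ∂(κ z) :=
      integral_congr_ae (hz0.mono fun ω hω => by
        have : X V ω = z.2 := by rw [← hω]
        simp only [linInterp, this]
        ring)
    have e2 : Integrable (fun ω => X s ω * X s ω) (κ z) := (hz1 s hs).integrable_mul (hz1 s hs)
    rw [hz4 s hs t ht hst, e1, integral_add (e2.const_mul _)
      (((hz1 s hs).integrable one_le_two).const_mul _), integral_const_mul, integral_const_mul,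
      hsq s hs, hmean s hs, max_eq_right hst.le, min_eq_left hst.le]
    simp only [linInterp, QHParams.F]
    field_simp
    ring

end BridgeLaw

/-! ### Affine functions and the Möbius time change -/

section Affine

theorem slopeΔ_affine {s u : ℝ} (h : s < u) (a b : ℝ) :
    slopeΔ s u (a * s + b) (a * u + b) = a := by
  have : u - s ≠ 0 := sub_ne_zero.2 h.ne'
  rw [slopeΔ]; field_simp; ring

theorem interceptΔ_affine {s u : ℝ} (h : s < u) (a b : ℝ) :
    interceptΔ s u (a * s + b) (a * u + b) = b := by
  have : u - s ≠ 0 := sub_ne_zero.2 h.ne'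
  rw [interceptΔ]; field_simp; ring

theorem linInterp_affine {s u : ℝ} (h : s < u) (t a b : ℝ) :
    linInterp s t u (a * s + b) (a * u + b) = a * t + b := by
  have : u - s ≠ 0 := sub_ne_zero.2 h.ne'
  rw [linInterp]; field_simp; ring

/-- Writing two values as those of a line makes slope, intercept and interpolation explicit, which
turns the later identities into polynomial ones. -/
theorem exists_affine {s u : ℝ} (h : s < u) (x y : ℝ) :
    ∃ a b : ℝ, x = a * s + b ∧ y = a * u + b := by
  have : u - s ≠ 0 := sub_ne_zero.2 h.ne'
  refine ⟨slopeΔ s u x y, interceptΔ s u x y, ?_, ?_⟩ <;>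
  · rw [slopeΔ, interceptΔ]; field_simp; ring

end Affine

/-- The time change turning the time of the bridge on `(R, V)` into `(0, ∞)`. -/
noncomputable def bridgeTime (R V t : ℝ) : ℝ := (t + R) / (1 + t / V)

section BridgeTime

variable {R V s t : ℝ}

theorem bridgeTime_eq (hV : 0 < V) (ht : 0 < t) : bridgeTime R V t = V * (t + R) / (V + t) := by
  rw [bridgeTime]; field_simp

theorem bridgeTime_sub (hV : 0 < V) (hs : 0 < s) (ht : 0 < t) :
    bridgeTime R V t - bridgeTime R V s = V * (V - R) * (t - s) / ((V + t) * (V + s)) := by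
  rw [bridgeTime_eq hV hs, bridgeTime_eq hV ht]; field_simp; ring

theorem bridgeTime_sub_left (hV : 0 < V) (ht : 0 < t) :
    bridgeTime R V t - R = t * (V - R) / (V + t) := by
  rw [bridgeTime_eq hV ht]; field_simp; ring

theorem right_sub_bridgeTime (hV : 0 < V) (ht : 0 < t) :
    V - bridgeTime R V t = V * (V - R) / (V + t) := by
  rw [bridgeTime_eq hV ht]; field_simp; ring

theorem bridgeTime_mem (hV : 0 < V) (hRV : R < V) (ht : 0 < t) : bridgeTime R V t ∈ Ioo R V := by
  have h := sub_pos.2 hRV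
  refine ⟨sub_pos.1 ?_, sub_pos.1 ?_⟩
  · rw [bridgeTime_sub_left hV ht]; positivity
  · rw [right_sub_bridgeTime hV ht]; positivity

theorem bridgeTime_lt (hV : 0 < V) (hRV : R < V) (hs : 0 < s) (hst : s < t) :
    bridgeTime R V s < bridgeTime R V t := by
  have h := sub_pos.2 hRV
  have h' := sub_pos.2 hst
  have ht := hs.trans hst
  rw [← sub_pos, bridgeTime_sub hV hs ht]; positivity

theorem bridgeTime_le (hV : 0 < V) (hRV : R < V) (hs : 0 < s) (hst : s ≤ t) :
    bridgeTime R V s ≤ bridgeTime R V t := by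
  rcases hst.eq_or_lt with rfl | hst
  · exact le_rfl
  · exact (bridgeTime_lt hV hRV hs hst).le

end BridgeTime

/-! ### Algebra of the transformed parameters and their invariants -/

namespace QHParams

variable {p : QHParams} {R V : ℝ} {z : ℝ × ℝ}

theorem bridgeM_sq_mul (hD : 0 < p.D R V) (hK : 0 < p.bridgeK R V z) :
    p.bridgeM R V z ^ 2 * p.D R V = p.bridgeK R V z := by
  rw [bridgeM, div_pow, Real.sq_sqrt hK.le, Real.sq_sqrt hD.le]
  field_simp

theorem bridgeM_pos (hD : 0 < p.D R V) (hK : 0 < p.bridgeK R V z) : 0 < p.bridgeM R V z :=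
  div_pos (Real.sqrt_pos.2 hK) (Real.sqrt_pos.2 hD)

theorem sq_bridge_factor (hV : 0 < V) (hRV : R < V) (hD : 0 < p.D R V)
    (hK : 0 < p.bridgeK R V z) :
    (√V / ((V - R) * p.bridgeM R V z)) ^ 2 = V * p.D R V / ((V - R) ^ 2 * p.bridgeK R V z) := by
  have hM := bridgeM_pos hD hK
  have hVR : V - R ≠ 0 := (sub_pos.2 hRV).ne'
  rw [div_pow, mul_pow, Real.sq_sqrt hV.le, ← bridgeM_sq_mul hD hK]
  field_simp

theorem bridge_D (hV : 0 < V) (hRV : R < V) (hD : 0 < p.D R V) {s u : ℝ} (hs : 0 < s)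
    (hu : 0 < u) : (p.bridge R V z).D s u =
      (V + u) * (V + s) * p.D (bridgeTime R V s) (bridgeTime R V u) / (V * p.D R V) := by
  have hVR : V - R ≠ 0 := (sub_pos.2 hRV).ne'
  have h1 : V + u ≠ 0 := by positivity
  have h2 : V + s ≠ 0 := by positivity
  simp only [bridge, D, bridgeTime_eq hV hs, bridgeTime_eq hV hu]
  change 0 < V * (1 + R * p.σ) + p.τ - R * p.γ at hD
  generalize hd : V * (1 + R * p.σ) + p.τ - R * p.γ = d at hD ⊢
  field_simp
  subst hd
  ring

/-- The arguments on the left are the slope and intercept, in the new time, of the transform of the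
line `A r + B`. Expanding `K A B` around the endpoint values gives a quadratic polynomial in them;
after division by `bridgeK` its constant term is `1` and its other coefficients are the parameters
in `bridge`. -/
theorem bridge_K (hV : 0 < V) (hRV : R < V) (hD : 0 < p.D R V) (hK : 0 < p.bridgeK R V z)
    (A B : ℝ) :
    (p.bridge R V z).K
      (√V / ((V - R) * p.bridgeM R V z) * (A + B / V - z.2 / V))
      (√V / ((V - R) * p.bridgeM R V z) * (A * R + B - z.1)) = p.K A B / p.bridgeK R V z := by
  obtain ⟨a, b, ha, hb⟩ := exists_affine hRV z.1 z.2
  have hM := bridgeM_pos hD hK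
  have hM2 := bridgeM_sq_mul hD hK
  have hC := sq_bridge_factor hV hRV hD hK
  have hVR : V - R ≠ 0 := (sub_pos.2 hRV).ne'
  have hr := Real.sqrt_pos.2 hV
  have hr2 := Real.sq_sqrt hV.le
  have hKe : p.bridgeK R V z = p.K a b := by
    rw [bridgeK, ha, hb, slopeΔ_affine hRV, interceptΔ_affine hRV]
  rw [hKe] at hK hM2 hC ⊢
  -- The next three identities eliminate `√V` and `bridgeM`: each term contains them only through
  -- `V` and `M ^ 2 * D = K`.
  have hη : ∀ N x : ℝ, N / (√V * p.bridgeM R V z * p.D R V) *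
      (√V / ((V - R) * p.bridgeM R V z) * x) = N * x / ((V - R) * p.K a b) := fun N x => by
    rw [← hM2]; field_simp
  have hθ : ∀ N x : ℝ, √V * N / (p.bridgeM R V z * p.D R V) *
      (√V / ((V - R) * p.bridgeM R V z) * x) = V * N * x / ((V - R) * p.K a b) := fun N x => by
    rw [← hM2]; field_simp; rw [hr2]; ring
  have hq : ∀ N x y : ℝ, N * (√V / ((V - R) * p.bridgeM R V z) * x *
      (√V / ((V - R) * p.bridgeM R V z) * y)) =
      N * x * y * (V * p.D R V / ((V - R) ^ 2 * p.K a b)) := fun N x y => by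
    rw [← hC]; ring
  rw [QHParams.K, sq (√V / ((V - R) * p.bridgeM R V z) * (A * R + B - z.1)),
    sq (√V / ((V - R) * p.bridgeM R V z) * (A + B / V - z.2 / V)), hq, hq, hq]
  simp only [bridge]
  rw [hη, hθ]
  rw [ha, hb, slopeΔ_affine hRV, interceptΔ_affine hRV]
  have hKd : p.K a b ≠ 0 := hK.ne'
  -- `K` and `D` are kept opaque so that denominators clear before they are expanded.
  generalize hk : p.K a b = k at hKd ⊢
  have hd0 := hD.ne'
  generalize hd : p.D R V = d at hd0 ⊢
  field_simp
  subst hk hd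
  simp only [QHParams.K, QHParams.D]
  ring

theorem bridge_one_add_γ (hD : 0 < p.D R V) :
    1 + (p.bridge R V z).γ = (V - R) * (1 + p.γ) / p.D R V := by
  have hd0 := hD.ne'
  simp only [bridge]
  generalize hd : p.D R V = d at hd0 ⊢
  field_simp
  subst hd
  simp only [D]
  ring

theorem bridge_discr (hV : 0 < V) (hD : 0 < p.D R V) :
    (1 - (p.bridge R V z).γ) ^ 2 - 4 * (p.bridge R V z).σ * (p.bridge R V z).τ =
      ((V - R) / p.D R V) ^ 2 * ((1 - p.γ) ^ 2 - 4 * p.σ * p.τ) := by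
  have hd0 := hD.ne'
  simp only [bridge]
  generalize hd : p.D R V = d at hd0 ⊢
  field_simp
  subst hd
  simp only [D]
  ring

theorem preservedByConditioning_bridge (hV : 0 < V) (hRV : R < V) (hD : 0 < p.D R V)
    (hK : 0 < p.bridgeK R V z) {c : ℝ} (hc : c ≠ 0) :
    PreservedByConditioning p ((p.bridge R V z).rescale c) R z := by
  have hVR := sub_pos.2 hRV
  have hγ := bridge_one_add_γ (z := z) hD
  refine ⟨⟨fun h => ?_, fun h => ?_⟩, fun h => ?_, fun hη hσ _ hR hz => ?_⟩
  · rw [h] at hγ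
    change (p.bridge R V z).γ = -1
    linarith [hγ, show (V - R) * (1 + -1) / p.D R V = 0 by simp]
  · change (p.bridge R V z).γ = -1 at h
    rw [h, add_neg_cancel, eq_comm, div_eq_zero_iff, mul_eq_zero] at hγ
    rcases hγ with (h1 | h1) | h1
    · exact absurd h1 hVR.ne'
    · linarith
    · exact absurd h1 hD.ne'
  · have h1 : 1 + p.γ ≠ 0 := by linarith
    have h2 : (1 - (p.bridge R V z).γ) ^ 2
        - 4 * ((p.bridge R V z).σ / c ^ 2) * (c ^ 2 * (p.bridge R V z).τ) =
        (1 - (p.bridge R V z).γ) ^ 2 - 4 * (p.bridge R V z).σ * (p.bridge R V z).τ := by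
      field_simp
    simp only [QHParams.rescale]
    rw [h2, bridge_discr hV hD, hγ]
    field_simp
  · subst hR
    have hM := bridgeM_pos hD hK
    have hM2 := bridgeM_sq_mul hD hK
    have hr2 := Real.sq_sqrt hV.le
    -- With zero intercept and `p.η = 0`, `K` is `1 + θ x + τ x ^ 2` in the slope `x`, and `(θ + 2 τ
    -- x) ^ 2 - 4 τ K = θ ^ 2 - 4 τ`.
    have key : (c * (p.bridge 0 V z).θ) ^ 2 - 4 * (c ^ 2 * (p.bridge 0 V z).τ) =
        c ^ 2 * (V / (p.D 0 V * p.bridgeK 0 V z)) * (p.θ ^ 2 - 4 * p.τ) := by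
      have hθ : (p.bridge 0 V z).θ ^ 2 = V * (p.θ + 2 * p.τ * slopeΔ 0 V z.1 z.2) ^ 2 /
          (p.D 0 V * p.bridgeK 0 V z) := by
        simp only [bridge, interceptΔ, hz]
        rw [← hM2, div_pow, mul_pow, hr2]
        field_simp
        ring
      have hKe : p.bridgeK 0 V z = 1 + p.θ * slopeΔ 0 V z.1 z.2
          + p.τ * slopeΔ 0 V z.1 z.2 ^ 2 := by
        simp [bridgeK, QHParams.K, interceptΔ, hz, hη]
      have hτ : (p.bridge 0 V z).τ = V * p.τ / p.D 0 V := by simp [bridge]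
      rw [mul_pow, hθ, hτ]
      have hK' := hK.ne'
      field_simp
      rw [hKe]
      ring
    simp only [QHParams.rescale]
    rw [key, sign_mul, sign_pos (by positivity), one_mul]

end QHParams

/-! ### From the bridge to a harness on `(0, ∞)` -/

section Transfer

variable {Ω : Type*} {G : MeasurableSpace Ω} [mΩ : MeasurableSpace Ω] {Q : Measure Ω}

theorem condExp_affine [IsFiniteMeasure Q] (hG : G ≤ mΩ) {X : Ω → ℝ} (hX : Integrable X Q)
    (a b : ℝ) : Q[fun ω => a * X ω - b | G] =ᵐ[Q] fun ω => a * Q[X | G] ω - b := by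
  have h1 := condExp_sub (hX.smul a) (integrable_const b) G
  filter_upwards [h1, condExp_smul a X G (μ := Q)] with ω h1 h2
  rw [condExp_const hG, Pi.sub_apply, h2] at h1
  exact h1

theorem condVar_affine [IsFiniteMeasure Q] (hG : G ≤ mΩ) {X : Ω → ℝ} (hX : Integrable X Q)
    (a b : ℝ) :
    Var[fun ω => a * X ω - b; Q | G] =ᵐ[Q] fun ω => a ^ 2 * Var[X; Q | G] ω := by
  have h1 : (fun ω => a * X ω - b) - Q[fun ω => a * X ω - b | G] =ᵐ[Q] a • (X - Q[X | G]) := by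
    filter_upwards [condExp_affine hG hX a b] with ω hω
    simp only [Pi.sub_apply, hω, Pi.smul_apply, smul_eq_mul]
    ring
  have h2 : Q[((fun ω => a * X ω - b) - Q[fun ω => a * X ω - b | G]) ^ 2 | G] =ᵐ[Q]
      Q[a ^ 2 • (X - Q[X | G]) ^ 2 | G] := condExp_congr_ae (by
    filter_upwards [h1] with ω hω
    simp only [Pi.pow_apply, hω, Pi.smul_apply, smul_eq_mul]
    ring)
  exact h2.trans (condExp_smul (a ^ 2) _ G)

theorem integral_affine_mul_affine [IsProbabilityMeasure Q] {X Y : Ω → ℝ} (hX : MemLp X 2 Q)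
    (hY : MemLp Y 2 Q) (a b c d : ℝ) :
    ∫ ω, (a * X ω - b) * (c * Y ω - d) ∂Q =
      a * c * ∫ ω, X ω * Y ω ∂Q - a * d * ∫ ω, X ω ∂Q - b * c * ∫ ω, Y ω ∂Q + b * d := by
  have i1 := (hX.integrable_mul hY).const_mul (a * c)
  have i2 := (hX.integrable one_le_two).const_mul (a * d)
  have i3 := (hY.integrable one_le_two).const_mul (b * c)
  have i4 := integrable_const (μ := Q) (b * d)
  have h : (fun ω => (a * X ω - b) * (c * Y ω - d)) =
      (fun ω => a * c * (X * Y) ω) - (fun ω => a * d * X ω) - (fun ω => b * c * Y ω)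
        + (fun _ => b * d) := by
    funext ω
    simp only [Pi.add_apply, Pi.mul_apply, Pi.sub_apply]
    ring
  rw [h, integral_add' ((i1.sub i2).sub i3) i4, integral_sub' (i1.sub i2) i3, integral_sub' i1 i2]
  simp [integral_const_mul]

theorem condExp_eq_of_setIntegral_timeSigma [IsFiniteMeasure Q] {X : ℝ → Ω → ℝ} {S : Set ℝ}
    (hX : ∀ r ∈ S, Measurable (X r)) {f g : Ω → ℝ} (hf : Integrable f Q) (hg : Integrable g Q)
    (hgm : StronglyMeasurable[timeSigma X S] g)
    (h : ∀ A, MeasurableSet[timeSigma X S] A → ∫ ω in A, f ω ∂Q = ∫ ω in A, g ω ∂Q) :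
    Q[f | timeSigma X S] =ᵐ[Q] g :=
  (ae_eq_condExp_of_forall_setIntegral_eq (timeSigma_le hX) hf (fun _ _ _ => hg.integrableOn)
    (fun A hA _ => (h A hA).symm) hgm.aestronglyMeasurable).symm

namespace BridgeLaw

variable {X : ℝ → Ω → ℝ} {p : QHParams} {R V a b m s t u : ℝ}

theorem condExp_eq [IsProbabilityMeasure Q] (h : BridgeLaw (Ioo R V) X Q p R V a b m)
    (hX : ∀ t ∈ Ioo R V, Measurable (X t)) (hs : s ∈ Ioo R V) (ht : t ∈ Ioo R V)
    (hu : u ∈ Ioo R V) (hst : s < t) (htu : t < u) :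
    Q[X t | timeSigma X (Ioo R V ∩ {r | r ≤ s ∨ u ≤ r})] =ᵐ[Q]
      fun ω => linInterp s t u (X s ω) (X u ω) := by
  refine condExp_eq_of_setIntegral_timeSigma (fun r hr => hX r hr.1)
    ((h.memLp t ht).integrable one_le_two)
    ((memLp_linInterp (h.memLp s hs) (h.memLp u hu) s t u).integrable one_le_two) ?_
    (h.setIntegral s hs t ht u hu hst htu)
  have h1 := measurable_timeSigma X (S := Ioo R V ∩ {r | r ≤ s ∨ u ≤ r}) ⟨hs, Or.inl le_rfl⟩
  have h2 := measurable_timeSigma X (S := Ioo R V ∩ {r | r ≤ s ∨ u ≤ r}) ⟨hu, Or.inr le_rfl⟩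
  exact ((h1.const_mul _).add (h2.const_mul _)).stronglyMeasurable

theorem condVar_eq [IsProbabilityMeasure Q] (h : BridgeLaw (Ioo R V) X Q p R V a b m)
    (hX : ∀ t ∈ Ioo R V, Measurable (X t)) (hs : s ∈ Ioo R V) (ht : t ∈ Ioo R V)
    (hu : u ∈ Ioo R V) (hst : s < t) (htu : t < u) :
    Var[X t; Q | timeSigma X (Ioo R V ∩ {r | r ≤ s ∨ u ≤ r})] =ᵐ[Q] fun ω =>
      p.F t s u * p.K (slopeΔ s u (X s ω) (X u ω)) (interceptΔ s u (X s ω) (X u ω)) := by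
  have h1 := measurable_timeSigma X (S := Ioo R V ∩ {r | r ≤ s ∨ u ≤ r}) ⟨hs, Or.inl le_rfl⟩
  have h2 := measurable_timeSigma X (S := Ioo R V ∩ {r | r ≤ s ∨ u ≤ r}) ⟨hu, Or.inr le_rfl⟩
  have hm : Measurable fun x : ℝ × ℝ => p.condSq s t u x.1 x.2 := by
    unfold QHParams.condSq linInterp QHParams.K slopeΔ interceptΔ
    fun_prop
  have h3 := condExp_eq_of_setIntegral_timeSigma (fun r hr => hX r hr.1)
    (h.memLp t ht).integrable_sq (integrable_condSq (h.memLp s hs) (h.memLp u hu) p s t u)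
    (hm.comp (h1.prodMk h2)).stronglyMeasurable (h.setIntegral_sq s hs t ht u hu hst htu)
  filter_upwards [h3, h.condExp_eq hX hs ht hu hst htu, condVar_ae_eq_condExp_sq_sub_sq_condExp
    (timeSigma_le fun r (hr : r ∈ Ioo R V ∩ {r | r ≤ s ∨ u ≤ r}) => hX r hr.1) (h.memLp t ht)]
    with ω e1 e2 e3
  rw [e3, Pi.sub_apply, Pi.pow_apply, e2]
  change Q[X t ^ 2 | timeSigma X (Ioo R V ∩ {r | r ≤ s ∨ u ≤ r})] ω = _ at e1
  rw [e1, QHParams.condSq]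
  ring

/-- The filtration is generated by the bridge at transformed times. Conditional moments pass through
the deterministic affine map at each time, and monotonicity of the time change preserves past and
future. -/
theorem memQH_bridgeTransform [IsProbabilityMeasure Q] {z : ℝ × ℝ}
    (h : BridgeLaw (Ioo R V) X Q p R V z.1 z.2 (p.bridgeK R V z / p.D R V))
    (hX : ∀ t ∈ Ioo R V, Measurable (X t)) (hp : -1 ≤ p.γ) (hV : 0 < V) (hRV : R < V)
    (hD : 0 < p.D R V) (hK : 0 < p.bridgeK R V z) :
    MemQH (Ioi 0) (bridgeTransform p R V z X) Q (p.bridge R V z) := by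
  set C := √V / ((V - R) * p.bridgeM R V z) with hC
  have hC2 : C ^ 2 = V * p.D R V / ((V - R) ^ 2 * p.bridgeK R V z) :=
    QHParams.sq_bridge_factor hV hRV hD hK
  have hVR := sub_pos.2 hRV
  have hY : ∀ t, bridgeTransform p R V z X t = fun ω =>
      C * (1 + t / V) * X (bridgeTime R V t) ω - C * (t * z.2 / V + z.1) := fun t => by
    funext ω
    rw [bridgeTransform, bridgeTime, ← hC]
    ring
  have hmem : ∀ {t : ℝ}, t ∈ Ioi (0 : ℝ) → bridgeTime R V t ∈ Ioo R V := fun ht =>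
    bridgeTime_mem hV hRV ht
  have hβ : ∀ {t : ℝ}, 0 < t →
      (1 + t / V) * linInterp R (bridgeTime R V t) V z.1 z.2 = t * z.2 / V + z.1 := fun ht => by
    rw [linInterp, bridgeTime_sub_left hV ht, right_sub_bridgeTime hV ht]
    field_simp
    ring
  -- The transform sends lines to lines; the new slope and intercept are those appearing in
  -- `QHParams.bridge_K`.
  have hline : ∀ {t : ℝ}, 0 < t → ∀ A B : ℝ,
      C * (1 + t / V) * (A * bridgeTime R V t + B) - C * (t * z.2 / V + z.1) =
        C * (A + B / V - z.2 / V) * t + C * (A * R + B - z.1) := fun ht A B => by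
    rw [bridgeTime_eq hV ht]
    field_simp
    ring
  have hle : ∀ s u, timeSigma X (Ioo R V ∩ {r | r ≤ s ∨ u ≤ r}) ≤ mΩ := fun s u =>
    timeSigma_le fun r hr => hX r hr.1
  refine ⟨fun s u => timeSigma X (Ioo R V ∩ {r | r ≤ bridgeTime R V s ∨ bridgeTime R V u ≤ r}),
    isOpen_Ioi, ordConnected_Ioi, nonempty_Ioi, subset_rfl, ?_, fun s _ u _ _ => hle _ _,
    ?_, ?_, ?_, ?_, ?_, ?_, ?_⟩
  · have h1 := QHParams.bridge_one_add_γ (z := z) hD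
    have h2 : 0 ≤ (V - R) * (1 + p.γ) / p.D R V :=
      div_nonneg (mul_nonneg hVR.le (by linarith)) hD.le
    linarith
  · intro r hr s hs t ht u hu hrs hst htu
    refine timeSigma_le fun x ⟨hx, hx'⟩ => measurable_timeSigma X ⟨hx, ?_⟩
    exact hx'.imp (fun h => h.trans (bridgeTime_le hV hRV hr hrs))
      (fun h => (bridgeTime_le hV hRV ht htu).trans h)
  · intro s hs u hu hsu r hr hrsu
    rw [hY]
    have hrS : bridgeTime R V r ∈
        Ioo R V ∩ {r | r ≤ bridgeTime R V s ∨ bridgeTime R V u ≤ r} :=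
      ⟨hmem hr, hrsu.imp (bridgeTime_le hV hRV hr) (bridgeTime_le hV hRV hu)⟩
    exact ((measurable_timeSigma X hrS).const_mul _).sub_const _
  · intro t ht
    rw [hY]
    exact ((h.memLp _ (hmem ht)).const_mul _).sub (memLp_const _)
  · intro t ht
    rw [hY, integral_sub (((h.memLp _ (hmem ht)).integrable one_le_two).const_mul _)
      (integrable_const _), integral_const_mul, h.mean _ (hmem ht), mul_assoc, hβ ht]
    simp
  · intro s hs t ht
    wlog hst : s ≤ t generalizing s t
    · rw [min_comm, ← this t ht s hs (le_of_not_ge hst)]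
      simp only [mul_comm]
    simp only [hY]
    rw [integral_affine_mul_affine (h.memLp _ (hmem hs)) (h.memLp _ (hmem ht)),
      h.cov _ (hmem hs) _ (hmem ht), h.mean _ (hmem hs), h.mean _ (hmem ht), ← hβ hs, ← hβ ht,
      min_eq_left hst, max_eq_right (bridgeTime_le hV hRV hs hst),
      min_eq_left (bridgeTime_le hV hRV hs hst), bridgeTime_sub_left hV hs,
      right_sub_bridgeTime hV ht]
    have hs' : 0 < s := hs
    have ht' : 0 < t := ht
    -- The constant `C` is chosen so that the bridge covariance becomes exactly `s`, the smaller
    -- time.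
    have e : C ^ 2 * ((1 + s / V) * (1 + t / V) * (p.bridgeK R V z / p.D R V *
        (V * (V - R) / (V + t) * (s * (V - R) / (V + s))))) = s := by
      rw [hC2]
      have := hK.ne'
      field_simp
    linear_combination e
  all_goals
    intro s hs t ht u hu hst htu
    have hst' := bridgeTime_lt hV hRV hs hst
    have htu' := bridgeTime_lt hV hRV ht htu
  · simp only [hY]
    filter_upwards [condExp_affine (hle (bridgeTime R V s) (bridgeTime R V u))
      ((h.memLp _ (hmem ht)).integrable one_le_two) (C * (1 + t / V)) (C * (t * z.2 / V + z.1)),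
      h.condExp_eq hX (hmem hs) (hmem ht) (hmem hu) hst' htu'] with ω e1 e2
    obtain ⟨A, B, hA, hB⟩ := exists_affine (hst'.trans htu') (X (bridgeTime R V s) ω)
      (X (bridgeTime R V u) ω)
    rw [e1, e2, hA, hB, linInterp_affine (hst'.trans htu'), hline ht, hline hs, hline hu]
    exact (linInterp_affine (hst.trans htu) t _ _).symm
  · simp only [hY]
    filter_upwards [condVar_affine (hle (bridgeTime R V s) (bridgeTime R V u))
      ((h.memLp _ (hmem ht)).integrable one_le_two) (C * (1 + t / V)) (C * (t * z.2 / V + z.1)),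
      h.condVar_eq hX (hmem hs) (hmem ht) (hmem hu) hst' htu'] with ω e1 e2
    obtain ⟨A, B, hA, hB⟩ := exists_affine (hst'.trans htu') (X (bridgeTime R V s) ω)
      (X (bridgeTime R V u) ω)
    rw [e1, e2, hA, hB, slopeΔ_affine (hst'.trans htu'), interceptΔ_affine (hst'.trans htu'),
      hline hs, hline hu, slopeΔ_affine (hst.trans htu), interceptΔ_affine (hst.trans htu),
      QHParams.bridge_K hV hRV hD hK, mul_pow, hC2, QHParams.F, QHParams.F,
      QHParams.bridge_D hV hRV hD hs hu, bridgeTime_sub hV hs ht, bridgeTime_sub hV ht hu]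
    have hs' : 0 < s := hs
    have ht' : 0 < t := ht
    have hu' : 0 < u := hu
    generalize p.D (bridgeTime R V s) (bridgeTime R V u) = d
    generalize p.K A B = k
    -- Nonvanishing of this inner denominator is not assumed here; when it is zero both variances
    -- are zero by the convention for division.
    rcases eq_or_ne d 0 with rfl | hd
    · simp
    have := hK.ne'
    field_simp

end BridgeLaw

theorem MemQH.rescale [IsFiniteMeasure Q] {Y : ℝ → Ω → ℝ} {q : QHParams} (h : MemQH (Ioi 0) Y Q q)
    {c : ℝ} (hc : c ≠ 0) : MemQH (Ioi 0) (rescale c Y) Q (q.rescale c) := by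
  obtain ⟨ℱ, h⟩ := h
  have hc2 : 0 < c ^ 2 := by positivity
  have hpos : ∀ {t : ℝ}, t ∈ Ioi (0 : ℝ) → t / c ^ 2 ∈ Ioi (0 : ℝ) := fun ht => div_pos ht hc2
  have hlt : ∀ {s t : ℝ}, s < t → s / c ^ 2 < t / c ^ 2 := fun hst =>
    div_lt_div_of_pos_right hst hc2
  have hle : ∀ {s t : ℝ}, s ≤ t → s / c ^ 2 ≤ t / c ^ 2 := fun hst =>
    div_le_div_of_nonneg_right hst hc2.le
  have hY : ∀ t, _root_.rescale c Y t = fun ω => c * Y (t / c ^ 2) ω - 0 := fun t => by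
    funext ω
    rw [sub_zero, _root_.rescale]
  refine ⟨fun s u => ℱ (s / c ^ 2) (u / c ^ 2), isOpen_Ioi, ordConnected_Ioi, nonempty_Ioi,
    subset_rfl, h.neg_one_le, fun s hs u hu hsu => h.le _ (hpos hs) _ (hpos hu) (hlt hsu),
    ?_, ?_, ?_, ?_, ?_, ?_, ?_⟩
  · intro r hr s hs t ht u hu hrs hst htu
    exact h.anti _ (hpos hr) _ (hpos hs) _ (hpos ht) _ (hpos hu) (hle hrs) (hlt hst) (hle htu)
  · intro s hs u hu hsu r hr hrsu
    exact (h.measurable _ (hpos hs) _ (hpos hu) (hlt hsu) _ (hpos hr)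
      (hrsu.imp hle hle)).const_mul c
  · exact fun t ht => (h.memLp _ (hpos ht)).const_mul c
  · intro t ht
    simp only [_root_.rescale, integral_const_mul, h.mean _ (hpos ht), mul_zero]
  · intro s hs t ht
    have e : ∀ ω, _root_.rescale c Y s ω * _root_.rescale c Y t ω =
        c ^ 2 * (Y (s / c ^ 2) ω * Y (t / c ^ 2) ω) := fun ω => by
      simp only [_root_.rescale]; ring
    simp only [e]
    rw [integral_const_mul, h.cov _ (hpos hs) _ (hpos ht), min_div_div_right hc2.le]
    field_simp
  all_goals
    intro s hs t ht u hu hst htu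
    have hsu := hst.trans htu
    have hne : u - s ≠ 0 := (sub_pos.2 hsu).ne'
  · simp only [hY]
    filter_upwards [condExp_affine (h.le _ (hpos hs) _ (hpos hu) (hlt hsu))
      ((h.memLp _ (hpos ht)).integrable one_le_two) c 0,
      h.condMean _ (hpos hs) _ (hpos ht) _ (hpos hu) (hlt hst) (hlt htu)] with ω e1 e2
    rw [e1, e2]
    field_simp
    ring
  · simp only [hY]
    filter_upwards [condVar_affine (h.le _ (hpos hs) _ (hpos hu) (hlt hsu))
      ((h.memLp _ (hpos ht)).integrable one_le_two) c 0,
      h.condVariance _ (hpos hs) _ (hpos ht) _ (hpos hu) (hlt hst) (hlt htu)] with ω e1 e2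
    obtain ⟨A, B, hA, hB⟩ := exists_affine (hlt hsu) (Y (s / c ^ 2) ω) (Y (u / c ^ 2) ω)
    have hs1 : c * (A * (s / c ^ 2) + B) - 0 = A / c * s + c * B := by field_simp; ring
    have hu1 : c * (A * (u / c ^ 2) + B) - 0 = A / c * u + c * B := by field_simp; ring
    rw [e1, e2, hA, hB, slopeΔ_affine (hlt hsu), interceptΔ_affine (hlt hsu), hs1, hu1,
      slopeΔ_affine hsu, interceptΔ_affine hsu]
    -- Rescaling multiplies `D` by `c ^ 2` and leaves `K` unchanged, which matches the `c ^ 2` in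
    -- the variance and the two factors of time.
    have hD : (q.rescale c).D s u = c ^ 2 * q.D (s / c ^ 2) (u / c ^ 2) := by
      simp only [QHParams.D, QHParams.rescale]; field_simp
    have hK : (q.rescale c).K (A / c) (c * B) = q.K A B := by
      simp only [QHParams.K, QHParams.rescale]; field_simp
    rw [QHParams.F, QHParams.F, hD, hK]
    generalize q.D (s / c ^ 2) (u / c ^ 2) = d
    rcases eq_or_ne d 0 with rfl | hd
    · simp
    field_simp

end Transfer

/-! ### The proposition -/

theorem propositionP {Ω : Type*} [MeasurableSpace Ω] (P : Measure Ω) [IsProbabilityMeasure P]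
    (T : Set ℝ) (Z : ℝ → Ω → ℝ) (p : QHParams) (hZ : MemQH T Z P p)
    -- `Z` is taken in its right-continuous version
    (hcont : ∀ᵐ ω ∂P, ∀ t ∈ T, ContinuousWithinAt (fun r => Z r ω) (Ici t) t)
    (R V : ℝ) (hV : V ∈ T) (hRV : R < V)
    -- either `R` is in the time interval, or the interval starts at `R = 0` and `Z 0 = 0`
    (hR : R ∈ T ∨ (R = 0 ∧ Ioo 0 V ⊆ T ∧ ∀ ω, Z 0 ω = 0))
    -- `κ` is a regular conditional probability given `(Z R, Z V)`
    (κ : Kernel (ℝ × ℝ) Ω) [IsMarkovKernel κ]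
    (hκ : (P.map fun ω => (Z R ω, Z V ω)) ⊗ₘ κ = P.map fun ω => ((Z R ω, Z V ω), ω)) :
    ∀ᵐ z ∂(P.map fun ω => (Z R ω, Z V ω)), 0 < p.bridgeK R V z →
      0 < p.D R V ∧
      ∀ c : ℝ, c ≠ 0 →
        -- every `q` which is the parameter vector of the transformed bridge
        (∀ q : QHParams,
          MemQH (Ioi 0) (rescale c (bridgeTransform p R V z Z)) (κ z) q →
          (∀ q' : QHParams,
            MemQH (Ioi 0) (rescale c (bridgeTransform p R V z Z)) (κ z) q' → q' = q) →
          PreservedByConditioning p q R z) ∧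
        -- in any case the transformed bridge has the parameters inherited from `Z`
        MemQH (Ioi 0) (rescale c (bridgeTransform p R V z Z)) (κ z)
          ((p.bridge R V z).rescale c) ∧
        PreservedByConditioning p ((p.bridge R V z).rescale c) R z := by
  obtain ⟨ℱ, h⟩ := hZ
  have hT := h.Ioo_subset hR hV
  have hV0 : 0 < V := h.pos hV
  have hZR : Measurable (Z R) := by
    rcases hR with hR | ⟨rfl, -, h0⟩
    · exact h.measurable_apply hR
    · rw [funext h0]; exact measurable_const
  have hW : Measurable fun ω => (Z R ω, Z V ω) := hZR.prodMk (h.measurable_apply hV)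
  -- If `K ≤ 0` almost everywhere, almost no endpoint value satisfies the positivity assumption and
  -- the claim is vacuous.
  rcases h.K_nonpos_or_D_pos hR hV hRV with hK | hD
  · have hm : Measurable fun z => p.bridgeK R V z := by
      unfold QHParams.bridgeK QHParams.K slopeΔ interceptΔ
      fun_prop
    have h1 : ∀ᵐ z ∂(P.map fun ω => (Z R ω, Z V ω)), p.bridgeK R V z ≤ 0 :=
      (ae_map_iff hW.aemeasurable (hm measurableSet_Iic)).2 hK
    filter_upwards [h1] with z hz hz'
    exact absurd hz' (not_lt.2 hz)
  · filter_upwards [h.ae_bridgeLaw_rat hV hRV hR hD.ne' hκ,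
      ae_ae_of_disintegration hW hκ hcont] with z hz hrc hK
    have hX : ∀ t ∈ Ioo R V, Measurable (Z t) := fun t ht => h.measurable_apply (hT ht)
    have hlaw := hz.of_rightContinuous (hrc.mono fun ω hω t ht => hω t (hT ht)) hX
      (div_pos hK hD).le fun s hs u hu hsu => h.D_ne_zero (hT hs) (hT hu) hsu
    refine ⟨hD, fun c hc => ?_⟩
    have hmem := (hlaw.memQH_bridgeTransform hX h.neg_one_le hV0 hRV hD hK).rescale hc
    have hpres := QHParams.preservedByConditioning_bridge hV0 hRV hD hK hc
    -- Uniqueness identifies any such `q` with the explicit parameters, for which the invariants are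
    -- already known.
    exact ⟨fun q _ huniq => huniq _ hmem ▸ hpres, hmem, hpres⟩
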